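/- Let $n\ge 1$, let $I\subseteq\mathbb R$ be a nonempty open interval, and let $\rho,\eta_1,\dots,\eta_{n-1}:I\to(0,\infty)$ be smooth. Let $M^n=I\times\mathbb R^{n-1}$ carry the Riemannian metric $$d\sigma^2=\rho(t)^2dt^2+\eta_1(t)^2dx_1^2+\dots+\eta_{n-1}(t)^2dx_{n-1}^2 .$$ Let $\mathbb R^N_a$ be $\mathbb R^N$ with $\langle\,,\rangle=-dx_1^2-\dots-dx_a^2+dx_{a+1}^2+\dots+dx_N^2$, and for $c>0$ let $\mathbb S^N_a(c)=\{x\in\mathbb R^{N+1}_a:\langle x,x\rangle=1/c\}$ and $\mathbb H^N_a(-c)=\{x\in\mathbb R^{N+1}_{a+1}:\langle x,x\rangle=-1/c\}$ with the induced metrics. Then, for all $c>0$ and $a\in\{0,\dots,n-1\}$, $M^n$ admits (i) smooth isometric immersions in $\mathbb R^{4n-3-2a}_a$, $\mathbb S^{4n-3-2a}_a(c)$ and $\mathbb H^{4n-3-a}_a(-c)$; (ii) smooth isometric embeddings (injective isometric immersions that are homeomorphisms onto their images) in $\mathbb R^{8n-7-6a}_a$, $\mathbb S^{8n-5-6a}_a(c)$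 and $\mathbb H^{8n-7-5a}_a(-c)$. Moreover, they can be given explicitly, as follows. Put $\xi(u)=\sin(\pi u)e^{-1/\sin^2(\pi u)}$ ($=0$ for $u\in\mathbb Z$), $A=\int_0^1\xi$, $\hat\psi_1(u)=\sqrt{\tfrac1A\int_0^{u+1}\xi}$, $\hat\psi_2(u)=\sqrt{\tfrac1A\int_0^{u}\xi}$, $T_1(u)=\frac\pi4(1+\tanh u)$, $T_2(u)=\int_0^u\sqrt{1-T_1'(\tau)^2}\,d\tau$, $h(u)=(\cosh u,\sinh u)\in\mathbb R^2_1$, $g(u)=(\cos u,\sin u)$. For each of the six maps there are an increasing smooth diffeomorphism $\gamma:I\to\mathbb R$, a point $t_0\in I$ and functions $S_1,S_2:I\to(0,\infty)$, with $S_1$ constant on each $\gamma^{-1}[2l+1,2l+3)$ and $S_2$ constant on each $\gamma^{-1}[2l,2l+2)$ ($l\in\mathbb Z$), such that the map has the form below, up to a reordering of coordinates that identifies the semi-Euclidean product with the ambient space. Here $b=n-1-a$, $\psi_j=\hat\psi_j\circ\gamma$, and $$\varphi_j(t,u)=\tfrac{\psi_j(t)}{S_j(t)}\,g(S_j(t)u),\qquad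 \varphi_{ji}(t,u)=\tfrac{\psi_j(t)}{S_j(t)}\,g\big(T_i(S_j(t)u)\big),\qquad i,j\in\{1,2\},$$ $$\epsilon^2=\sum_{r>a}\sum_{j=1}^2\frac{((\eta_r\psi_j)')^2}{S_j^2},\quad \alpha=\sum_{r>a}\sum_{j=1}^2\frac{\eta_r^2\psi_j^2}{S_j^2},\quad \tilde\eta=(\eta_1,\dots,\eta_a),\quad \beta=\alpha-|\tilde\eta|^2,$$ $$X=\big(\eta_k(t)h(x_k)\big)_{k\le a}\in(\mathbb R^2_1)^a,\quad Y=\big(\eta_r(t)\varphi_j(t,x_r)\big)_{r>a;\,j}\in\mathbb R^{4b},\quad \hat Y=\big(\eta_r(t)\varphi_{ji}(t,x_r)\big)_{r>a;\,j,i}\in\mathbb R^{8b}.$$ The immersions at $(t,x)$ are, in $\mathbb R\times(\mathbb R^2_1)^a\times\mathbb R^{4b}$, $\mathbb R^2\times(\mathbb R^2_1)^a\times\mathbb R^{4b}$ and $\mathbb R^2_1\times\mathbb R^a\times(\mathbb R^2_1)^a\times\mathbb R^{4b}$ respectively, $$\Big(\int_{t_0}^t\!\sqrt{\rho^2+|\tilde\eta'|^2-\epsilon^2},\,X,\,Y\Big),\qquad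 \Big(\sqrt{\tfrac1c-\beta(t)}\;g(\theta_s(t)),\,X,\,Y\Big),\qquad \Big(\sqrt{\tfrac1c+\alpha(t)}\;h(\theta_h(t)),\,\tilde\eta(t),\,X,\,Y\Big),$$ $$\theta_s(t)=\int_{t_0}^t\!\sqrt{\tfrac1{\frac1c-\beta}\Big[\rho^2+|\tilde\eta'|^2-\epsilon^2-\tfrac{(\beta')^2}{4(\frac1c-\beta)}\Big]},\qquad \theta_h(t)=\int_{t_0}^t\!\sqrt{\tfrac1{\frac1c+\alpha}\Big[\rho^2-\epsilon^2+\tfrac{(\alpha')^2}{4(\frac1c+\alpha)}\Big]} .$$ The embeddings are, in $\mathbb R\times(\mathbb R^2_1)^a\times\mathbb R^{8b}$, $\mathbb R^4\times(\mathbb R^2_1)^a\times\mathbb R^{8b}$ and $\mathbb R^2_1\times\mathbb R^a\times(\mathbb R^2_1)^a\times\mathbb R^{8b}$ respectively, $$\Big(\int_{t_0}^t\!\sqrt{\rho^2+|\tilde\eta'|^2-2\epsilon^2},\,X,\,\hat Y\Big),\qquad \Big(\sqrt{\omega(t)}\,\big(g(T_1(\hat\theta_s(t))),g(T_2(\hat\theta_s(t)))\big),\,X,\,\hat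 Y\Big),\qquad \Big(\sqrt{\tfrac1c+2\alpha(t)}\;h(\hat\theta_h(t)),\,\tilde\eta(t),\,X,\,\hat Y\Big),$$ where $\omega=\frac1{2c}+\frac{|\tilde\eta|^2}2-\alpha$ and $$\hat\theta_s(t)=\int_{t_0}^t\!\sqrt{\tfrac1{\omega}\Big[\rho^2+|\tilde\eta'|^2-2\epsilon^2-\tfrac{(\omega')^2}{2\omega}\Big]},\qquad \hat\theta_h(t)=\int_{t_0}^t\!\sqrt{\tfrac1{\frac1c+2\alpha}\Big[\rho^2-2\epsilon^2+\tfrac{(\alpha')^2}{\frac1c+2\alpha}\Big]} .$$ -/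

import Mathlib

open scoped ContDiff

noncomputable section

namespace WarpedQuadric

/-! ### Semi-Euclidean spaces and quadrics -/

/-- The sign of the `i`-th coordinate of `ℝ^N_a`: the first `a` coordinates are negative. -/
def sgn (a : ℕ) {N : ℕ} (i : Fin N) : ℝ := if (i : ℕ) < a then -1 else 1

/-- The inner product of index `a` on `ℝ^N`, that is
`-dx_1² - ⋯ - dx_a² + dx_{a+1}² + ⋯ + dx_N²`. -/
def semiInner (a : ℕ) {N : ℕ} (v w : Fin N → ℝ) : ℝ := ∑ i, sgn a i * v i * w i

/-- The quadric `S^N_a(c) = {x ∈ ℝ^{N+1}_a : ⟨x, x⟩ = 1 / c}`. -/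
def quadricS (N a : ℕ) (c : ℝ) : Set (Fin (N + 1) → ℝ) := {x | semiInner a x x = 1 / c}

/-- The quadric `H^N_a(-c) = {x ∈ ℝ^{N+1}_{a+1} : ⟨x, x⟩ = -1 / c}`. -/
def quadricH (N a : ℕ) (c : ℝ) : Set (Fin (N + 1) → ℝ) := {x | semiInner (a + 1) x x = -1 / c}

/-! ### The multiple warped product and its isometric immersions and embeddings -/

/-- The underlying set `I × ℝ^m` of the multiple warped product. -/
def domain (I : Set ℝ) (m : ℕ) : Set (ℝ × (Fin m → ℝ)) := I ×ˢ Set.univ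

/-- The metric `ρ(t)² dt² + ∑ j, η_j(t)² dx_j²` at a point with first coordinate `t`. -/
def warpedMetric {m : ℕ} (ρ : ℝ → ℝ) (η : Fin m → ℝ → ℝ) (t : ℝ) (v w : ℝ × (Fin m → ℝ)) : ℝ :=
  ρ t ^ 2 * v.1 * w.1 + ∑ j, η j t ^ 2 * v.2 j * w.2 j

/-- `f` is a smooth isometric immersion of `I × ℝ^m`, with the multiple warped product metric,
into `Q ⊆ ℝ^N_a` with the metric induced by `ℝ^N_a`. The map `f` is total for convenience;
only its restriction to the open set `domain I m` matters. -/
structure IsIsometricImmersion {m N : ℕ} (I : Set ℝ) (ρ : ℝ → ℝ) (η : Fin m → ℝ → ℝ) (a : ℕ)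
    (Q : Set (Fin N → ℝ)) (f : ℝ × (Fin m → ℝ) → Fin N → ℝ) : Prop where
  smooth : ContDiffOn ℝ ∞ f (domain I m)
  mapsTo : Set.MapsTo f (domain I m) Q
  immersion : ∀ p ∈ domain I m, Function.Injective (fderiv ℝ f p)
  isometric : ∀ p ∈ domain I m, ∀ v w : ℝ × (Fin m → ℝ),
    semiInner a (fderiv ℝ f p v) (fderiv ℝ f p w) = warpedMetric ρ η p.1 v w

/-- A smooth isometric embedding: a smooth isometric immersion that is injective and a
homeomorphism onto its image. -/
structure IsIsometricEmbedding {m N : ℕ} (I : Set ℝ) (ρ : ℝ → ℝ) (η : Fin m → ℝ → ℝ) (a : ℕ)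
    (Q : Set (Fin N → ℝ)) (f : ℝ × (Fin m → ℝ) → Fin N → ℝ) : Prop
    extends IsIsometricImmersion I ρ η a Q f where
  embedding : Topology.IsEmbedding ((domain I m).domRestrict f)

/-! ### The explicit formulas -/

/-- The function `sin (π u) exp (-1 / sin² (π u))`, which is `0` at the integers. -/
def xi (u : ℝ) : ℝ := Real.sin (Real.pi * u) * Real.exp (-1 / Real.sin (Real.pi * u) ^ 2)

/-- The shifts `1` (for the first function) and `0` (for the second). -/
def shift : Fin 2 → ℝ := ![1, 0]

/-- The two functions of Blanuša, `u ↦ √((1 / A) ∫_0^{u+1} ξ)` and `u ↦ √((1 / A) ∫_0^u ξ)`,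
where `A = ∫_0^1 ξ`. -/
def psiHat (j : Fin 2) (u : ℝ) : ℝ :=
  Real.sqrt (1 / (∫ τ in (0 : ℝ)..1, xi τ) * ∫ τ in (0 : ℝ)..(u + shift j), xi τ)

/-- The auxiliary choices: an increasing smooth diffeomorphism `γ` of the open interval `I` onto
`ℝ`, a base point `t₀ ∈ I`, and two positive step functions, the first of them constant on the
intervals `γ⁻¹ [2l+1, 2l+3)` and the second constant on the intervals `γ⁻¹ [2l, 2l+2)`. -/
structure Choices (I : Set ℝ) where
  γ : ℝ → ℝ
  γ_smooth : ContDiffOn ℝ ∞ γ I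
  γ_deriv_pos : ∀ t ∈ I, 0 < deriv γ t
  γ_surj : γ '' I = Set.univ
  t₀ : ℝ
  t₀_mem : t₀ ∈ I
  S : Fin 2 → ℝ → ℝ
  S_pos : ∀ j, ∀ t ∈ I, 0 < S j t
  S_step : ∀ j, ∀ l : ℤ, ∀ t ∈ I, ∀ t' ∈ I,
    γ t ∈ Set.Ico (2 * l + shift j) (2 * l + shift j + 2) →
    γ t' ∈ Set.Ico (2 * l + shift j) (2 * l + shift j + 2) → S j t = S j t'

/-- The function `T_1(u) = (π / 4) (1 + tanh u)`. -/
def T₁ (u : ℝ) : ℝ := Real.pi / 4 * (1 + Real.tanh u)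

/-- The function `T_2(u) = ∫_0^u √(1 - T_1'(τ)²) dτ`. -/
def T₂ (u : ℝ) : ℝ := ∫ τ in (0 : ℝ)..u, Real.sqrt (1 - deriv T₁ τ ^ 2)

/-- The pair `(T_1, T_2)`. -/
def T : Fin 2 → ℝ → ℝ := ![T₁, T₂]

/-- The curve `h(u) = (cosh u, sinh u)`. -/
def h (u : ℝ) : Fin 2 → ℝ := ![Real.cosh u, Real.sinh u]

/-- The curve `g(u) = (cos u, sin u)`. -/
def g (u : ℝ) : Fin 2 → ℝ := ![Real.cos u, Real.sin u]

/-- Indices of the first `a` of the `m` variables. -/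
abbrev Lo (m a : ℕ) : Type := {k : Fin m // (k : ℕ) < a}

/-- Indices of the remaining `m - a` variables. -/
abbrev Hi (m a : ℕ) : Type := {r : Fin m // a ≤ (r : ℕ)}

section formulas

variable {I : Set ℝ} {m : ℕ} (D : Choices I) (a : ℕ) (c : ℝ) (ρ : ℝ → ℝ) (η : Fin m → ℝ → ℝ)

/-- `ψ_j = ψHat_j ∘ γ`. -/
def psi (j : Fin 2) (t : ℝ) : ℝ := psiHat j (D.γ t)

/-- `φ_j(t, u) = (ψ_j(t) / S_j(t)) (cos (S_j(t) u), sin (S_j(t) u))`. -/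
def phi (j : Fin 2) (t u : ℝ) : Fin 2 → ℝ := (psi D j t / D.S j t) • g (D.S j t * u)

/-- `φ_{ji}(t, u) = (ψ_j(t) / S_j(t)) (cos (T_i (S_j(t) u)), sin (T_i (S_j(t) u)))`. -/
def phiHat (j i : Fin 2) (t u : ℝ) : Fin 2 → ℝ := (psi D j t / D.S j t) • g (T i (D.S j t * u))

/-- `∑_{k ≤ a} η_k(t)²`. -/
def loSq (t : ℝ) : ℝ := ∑ k : Lo m a, η k t ^ 2

/-- `∑_{k ≤ a} η_k'(t)²`. -/
def loDerivSq (t : ℝ) : ℝ := ∑ k : Lo m a, deriv (η k) t ^ 2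

/-- `ε(t)² = ∑_{r > a} ∑_j ((η_r ψ_j)'(t))² / S_j(t)²`. -/
def epsSq (t : ℝ) : ℝ :=
  ∑ r : Hi m a, ∑ j : Fin 2, deriv (fun s => η r s * psi D j s) t ^ 2 / D.S j t ^ 2

/-- `α(t) = ∑_{r > a} ∑_j η_r(t)² ψ_j(t)² / S_j(t)²`. -/
def alpha (t : ℝ) : ℝ :=
  ∑ r : Hi m a, ∑ j : Fin 2, η r t ^ 2 * psi D j t ^ 2 / D.S j t ^ 2

/-- `β(t) = α(t) - ∑_{k ≤ a} η_k(t)²`. -/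
def beta (t : ℝ) : ℝ := alpha D a η t - loSq a η t

/-- The block `(η_k(t))_{k ≤ a}`. -/
def loBlock (t : ℝ) : Lo m a → ℝ := fun k => η k t

/-- The block `(η_k(t) h(x_k))_{k ≤ a}`. -/
def hBlock (t : ℝ) (x : Fin m → ℝ) : Lo m a × Fin 2 → ℝ :=
  fun q => η q.1 t * h (x q.1) q.2

/-- The block `(η_r(t) (φ_1, φ_2)(t, x_r))_{r > a}`. -/
def phiBlock (t : ℝ) (x : Fin m → ℝ) : Hi m a × Fin 2 × Fin 2 → ℝ :=
  fun q => η q.1 t * phi D q.2.1 t (x q.1) q.2.2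

/-- The block `(η_r(t) (φ_{11}, φ_{21}, φ_{12}, φ_{22})(t, x_r))_{r > a}`. -/
def phiHatBlock (t : ℝ) (x : Fin m → ℝ) : Hi m a × (Fin 2 × Fin 2) × Fin 2 → ℝ :=
  fun q => η q.1 t * phiHat D q.2.1.1 q.2.1.2 t (x q.1) q.2.2

/-- `θ_h`, for the immersion into `H`. -/
def thetaH (t : ℝ) : ℝ :=
  ∫ τ in D.t₀..t, Real.sqrt (1 / (1 / c + alpha D a η τ) *
    (ρ τ ^ 2 - epsSq D a η τ + deriv (alpha D a η) τ ^ 2 / (4 * (1 / c + alpha D a η τ))))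

/-- `θ_s`, for the immersion into `S`. -/
def thetaS (t : ℝ) : ℝ :=
  ∫ τ in D.t₀..t, Real.sqrt (1 / (1 / c - beta D a η τ) *
    (ρ τ ^ 2 + loDerivSq a η τ - epsSq D a η τ
      - deriv (beta D a η) τ ^ 2 / (4 * (1 / c - beta D a η τ))))

/-- `θHat_h`, for the embedding into `H`. -/
def thetaHatH (t : ℝ) : ℝ :=
  ∫ τ in D.t₀..t, Real.sqrt (1 / (1 / c + 2 * alpha D a η τ) *
    (ρ τ ^ 2 - 2 * epsSq D a η τ + deriv (alpha D a η) τ ^ 2 / (1 / c + 2 * alpha D a η τ)))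

/-- `1 / (2c) + (1 / 2) ∑_{k ≤ a} η_k(t)² - α(t)`. -/
def radSq (t : ℝ) : ℝ := 1 / (2 * c) + loSq a η t / 2 - alpha D a η t

/-- `θHat_s`, for the embedding into `S`. -/
def thetaHatS (t : ℝ) : ℝ :=
  ∫ τ in D.t₀..t, Real.sqrt
    ((ρ τ ^ 2 + loDerivSq a η τ - 2 * epsSq D a η τ
      - 2 * (deriv (fun s => -alpha D a η s + loSq a η s / 2) τ ^ 2 / (4 * radSq D a c η τ)))
      / radSq D a c η τ)

/-- The immersion into `ℝ_a`, in the coordinates of `ℝ × (ℝ²_1)^a × ℝ^{4b}`. -/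
def mapR (p : ℝ × (Fin m → ℝ)) : Unit ⊕ (Lo m a × Fin 2) ⊕ (Hi m a × Fin 2 × Fin 2) → ℝ :=
  Sum.elim
    (fun _ => ∫ τ in D.t₀..p.1, Real.sqrt (ρ τ ^ 2 + loDerivSq a η τ - epsSq D a η τ))
    (Sum.elim (hBlock a η p.1 p.2) (phiBlock D a η p.1 p.2))

/-- The immersion into `H`, in the coordinates of `ℝ²_1 × ℝ^a × (ℝ²_1)^a × ℝ^{4b}`. -/
def mapH (p : ℝ × (Fin m → ℝ)) :
    Fin 2 ⊕ Lo m a ⊕ (Lo m a × Fin 2) ⊕ (Hi m a × Fin 2 × Fin 2) → ℝ :=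
  Sum.elim
    (Real.sqrt (1 / c + alpha D a η p.1) • h (thetaH D a c ρ η p.1))
    (Sum.elim (loBlock a η p.1) (Sum.elim (hBlock a η p.1 p.2) (phiBlock D a η p.1 p.2)))

/-- The immersion into `S`, in the coordinates of `ℝ² × (ℝ²_1)^a × ℝ^{4b}`. -/
def mapS (p : ℝ × (Fin m → ℝ)) : Fin 2 ⊕ (Lo m a × Fin 2) ⊕ (Hi m a × Fin 2 × Fin 2) → ℝ :=
  Sum.elim
    (Real.sqrt (1 / c - beta D a η p.1) • g (thetaS D a c ρ η p.1))
    (Sum.elim (hBlock a η p.1 p.2) (phiBlock D a η p.1 p.2))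

/-- The embedding into `ℝ_a`, in the coordinates of `ℝ × (ℝ²_1)^a × ℝ^{8b}`. -/
def mapHatR (p : ℝ × (Fin m → ℝ)) :
    Unit ⊕ (Lo m a × Fin 2) ⊕ (Hi m a × (Fin 2 × Fin 2) × Fin 2) → ℝ :=
  Sum.elim
    (fun _ => ∫ τ in D.t₀..p.1, Real.sqrt (ρ τ ^ 2 + loDerivSq a η τ - 2 * epsSq D a η τ))
    (Sum.elim (hBlock a η p.1 p.2) (phiHatBlock D a η p.1 p.2))

/-- The embedding into `H`, in the coordinates of `ℝ²_1 × ℝ^a × (ℝ²_1)^a × ℝ^{8b}`. -/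
def mapHatH (p : ℝ × (Fin m → ℝ)) :
    Fin 2 ⊕ Lo m a ⊕ (Lo m a × Fin 2) ⊕ (Hi m a × (Fin 2 × Fin 2) × Fin 2) → ℝ :=
  Sum.elim
    (Real.sqrt (1 / c + 2 * alpha D a η p.1) • h (thetaHatH D a c ρ η p.1))
    (Sum.elim (loBlock a η p.1) (Sum.elim (hBlock a η p.1 p.2) (phiHatBlock D a η p.1 p.2)))

/-- The embedding into `S`, in the coordinates of `ℝ⁴ × (ℝ²_1)^a × ℝ^{8b}`; the `ℝ⁴`-part is
`√radSq (cos T_1(θ), sin T_1(θ), cos T_2(θ), sin T_2(θ))` with `θ = θHat_s(t)`. -/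
def mapHatS (p : ℝ × (Fin m → ℝ)) :
    (Fin 2 × Fin 2) ⊕ (Lo m a × Fin 2) ⊕ (Hi m a × (Fin 2 × Fin 2) × Fin 2) → ℝ :=
  Sum.elim
    (fun q => Real.sqrt (radSq D a c η p.1) * g (T q.1 (thetaHatS D a c ρ η p.1)) q.2)
    (Sum.elim (hBlock a η p.1 p.2) (phiHatBlock D a η p.1 p.2))

end formulas

/-- The signs `(-1, 1)` of the coordinates of `ℝ²_1`. -/
def sgn₂ : Fin 2 → ℝ := ![-1, 1]

/-- The signs of the coordinates of `A × (ℝ²_1)^a × B` with `A` and `B` Euclidean. -/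
def sgnRS (A : Type) (m a : ℕ) (B : Type) : A ⊕ (Lo m a × Fin 2) ⊕ B → ℝ :=
  Sum.elim (fun _ => 1) (Sum.elim (fun q => sgn₂ q.2) (fun _ => 1))

/-- The signs of the coordinates of `ℝ²_1 × ℝ^a × (ℝ²_1)^a × B` with `B` Euclidean. -/
def sgnH (m a : ℕ) (B : Type) : Fin 2 ⊕ Lo m a ⊕ (Lo m a × Fin 2) ⊕ B → ℝ :=
  Sum.elim sgn₂ (Sum.elim (fun _ => 1) (Sum.elim (fun q => sgn₂ q.2) (fun _ => 1)))

/-- `f` is, on `I × ℝ^m`, the map `F` after an identification of the semi-Euclidean product whose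
coordinates are indexed by `ι` and have the signs `σ` with `ℝ^N_a` by a sign preserving
reordering of the coordinates. -/
def IsGivenBy {m N : ℕ} {ι : Type} (I : Set ℝ) (a : ℕ) (σ : ι → ℝ)
    (F : ℝ × (Fin m → ℝ) → ι → ℝ) (f : ℝ × (Fin m → ℝ) → Fin N → ℝ) : Prop :=
  ∃ e : Fin N ≃ ι, (∀ i, σ (e i) = sgn a i) ∧ ∀ p ∈ domain I m, ∀ i, f p i = F p (e i)

end WarpedQuadric

end

/-!
The metric of `I × ℝ^m` splits into blocks, one for each fibre coordinate `x_k`, and each block is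
realised by plane curves.

* For `k ≤ a` the hyperbola `η_k(t) h(x_k)` in `ℝ²_1` induces `-η_k'² dt² + η_k² dx_k²`.
* For `r > a` a single circle `η_r g(x_r)` would induce `η_r'² dt² + η_r² dx_r²`, with an excess
  `η_r'²` that may exceed `ρ²`. Instead one uses two circles of radii `η_r ψ_j / S_j` and angles
  `S_j x_r`. As `ψ_1² + ψ_2² = 1` they induce the right `η_r² dx_r²`, and the excess
  `∑_j ((η_r ψ_j)')² / S_j²` becomes small when the step functions `S_j` are large. The steps are
  relatively compact in `I`, so the `S_j` can be chosen to dominate any given continuous function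
  (`exists_choices`).

What is left over in `dt²` is then positive and is realised by a curve in the remaining
coordinates that depends on `t` only. For the quadrics, this curve also has to correct the squared
norm, which fixes its radius and leaves its angle, a primitive of a square root, to be chosen.
Positivity of the radicands (`radicandS_pos`, `radicandHatS_pos`) rests on the Cauchy-Schwarz
inequality: `α'² ≤ 4 α ε²` (`sq_deriv_alpha_le`), so that `α'` is small together with `α` and
`ε²`, and `(|η̃|²)'² ≤ 4 |η̃|² |η̃'|²`, so that the term that is not small is absorbed by
`|η̃'|²`. A single choice of `γ`, `t₀`, `S_1`, `S_2` serves all six maps.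

The jumps of `S_j` do no harm as `ψ_j` vanishes there to infinite order. This is the analytic core
(`contDiff_bump`). Near its zero `0` the primitive of `ξ` is `e^{-1/s²} r²` with `s = sin (π u)`,
and `s`, `cos (π u)`, `1/s`, `r`, `1/r` generate an algebra of functions that is closed under
differentiation and in which all functions grow at most like a power of `1/s`
(`exists_deriv_mem_tame`, `exists_bound_of_mem_tame`). The product of such a function with the
flat factor `e^{-1/(2s²)}`, cut off at `0`, is therefore smooth. Hence `ψ_j` is locally a sum of
two smooth bumps each of which sees one value of `S_j` only (`exists_local_splitting`), and all
formulas may be differentiated as if `S_j` were constant (`fderiv_rotating`).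

For the embeddings each circle is replaced by two circles with angles `T_1` and `T_2`, where
`T_1'² + T_2'² = 1` and `T_1` is injective with values in `(0, π / 2)`. The coordinates of the image
then determine the point continuously: first `t`, by a strictly monotone function, and then the
fibre coordinates (`le_nhds_of_tendsto_blocks`).
-/

noncomputable section

namespace WarpedQuadric

open Set Filter Topology

/-! ### The primitive of `ξ` -/

/-- The primitive `u ↦ ∫_0^u ξ`. -/
def xiPrim (u : ℝ) : ℝ := ∫ τ in (0 : ℝ)..u, xi τ

/-- At the zeros of the sine, `expNegInvGlue` and the junk value `exp (-1 / 0) = 1` differ, but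
both are multiplied by `0`. -/
lemma xi_eq (u : ℝ) :
    xi u = Real.sin (Real.pi * u) * expNegInvGlue (Real.sin (Real.pi * u) ^ 2) := by
  unfold xi expNegInvGlue
  rcases eq_or_ne (Real.sin (Real.pi * u)) 0 with h0 | h0
  · simp [h0]
  · have : ¬ Real.sin (Real.pi * u) ^ 2 ≤ 0 := not_le.2 (by positivity)
    rw [if_neg this, neg_div, one_div]

lemma contDiff_xi : ContDiff ℝ ∞ xi := by
  have : xi = fun u =>
      Real.sin (Real.pi * u) * expNegInvGlue (Real.sin (Real.pi * u) ^ 2) := funext xi_eq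
  rw [this]
  have h1 : ContDiff ℝ ∞ fun u : ℝ => Real.sin (Real.pi * u) := by fun_prop
  exact h1.mul ((expNegInvGlue.contDiff (n := ⊤)).comp (h1.pow 2))

lemma continuous_xi : Continuous xi := contDiff_xi.continuous

lemma hasDerivAt_xiPrim (u : ℝ) : HasDerivAt xiPrim (xi u) u :=
  intervalIntegral.integral_hasDerivAt_right (continuous_xi.intervalIntegrable _ _)
    (continuous_xi.stronglyMeasurableAtFilter _ _) continuous_xi.continuousAt

lemma contDiff_xiPrim : ContDiff ℝ ∞ xiPrim := by
  refine contDiff_infty_iff_deriv.2 ⟨fun u => (hasDerivAt_xiPrim u).differentiableAt, ?_⟩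
  rw [show deriv xiPrim = xi from funext fun u => (hasDerivAt_xiPrim u).deriv]
  exact contDiff_xi

lemma xi_neg (u : ℝ) : xi (-u) = -xi u := by simp [xi]

lemma xi_add_one (u : ℝ) : xi (u + 1) = -xi u := by
  simp [xi, mul_add, Real.sin_add_pi]

lemma xiPrim_zero : xiPrim 0 = 0 := by simp [xiPrim]

lemma xiPrim_neg (u : ℝ) : xiPrim (-u) = xiPrim u := by
  have h1 := intervalIntegral.integral_comp_neg (a := 0) (b := u) xi
  simp only [xi_neg, neg_zero, intervalIntegral.integral_neg] at h1
  rw [intervalIntegral.integral_symm 0 (-u)] at h1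
  unfold xiPrim
  linarith

/-- The primitives at `u` and `u + 1` have a constant sum since `ξ` has antiperiod `1`. -/
lemma xiPrim_add_xiPrim_add_one (u : ℝ) : xiPrim u + xiPrim (u + 1) = xiPrim 1 := by
  have h1 := intervalIntegral.integral_comp_add_right (a := 0) (b := u) xi 1
  simp only [xi_add_one, zero_add, intervalIntegral.integral_neg] at h1
  have h2 := intervalIntegral.integral_add_adjacent_intervals
    (continuous_xi.intervalIntegrable (μ := MeasureTheory.volume) 0 1)
    (continuous_xi.intervalIntegrable 1 (u + 1))
  unfold xiPrim
  linarith

lemma xiPrim_add_two (u : ℝ) : xiPrim (u + 2) = xiPrim u := by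
  have h1 := xiPrim_add_xiPrim_add_one u
  have h2 := xiPrim_add_xiPrim_add_one (u + 1)
  rw [show u + 1 + 1 = u + 2 by ring] at h2
  linarith

lemma xi_pos {u : ℝ} (h0 : 0 < u) (h1 : u < 1) : 0 < xi u := by
  have : 0 < Real.sin (Real.pi * u) := Real.sin_pos_of_pos_of_lt_pi (by positivity)
    (by nlinarith [Real.pi_pos])
  unfold xi
  positivity

lemma xiPrim_pos_of_le_one {u : ℝ} (h0 : 0 < u) (h1 : u ≤ 1) : 0 < xiPrim u :=
  intervalIntegral.intervalIntegral_pos_of_pos_on (continuous_xi.intervalIntegrable _ _)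
    (fun _ hx => xi_pos hx.1 (hx.2.trans_le h1)) h0

lemma xiPrim_two_sub (u : ℝ) : xiPrim (2 - u) = xiPrim u := by
  rw [show 2 - u = -u + 2 by ring, xiPrim_add_two, xiPrim_neg]

lemma xiPrim_pos {u : ℝ} (h0 : 0 < u) (h2 : u < 2) : 0 < xiPrim u := by
  rcases le_total u 1 with h | h
  · exact xiPrim_pos_of_le_one h0 h
  · rw [← xiPrim_two_sub]
    exact xiPrim_pos_of_le_one (by linarith) (by linarith)

lemma xiPrim_add_two_mul (u : ℝ) (l : ℤ) : xiPrim (u + 2 * l) = xiPrim u := by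
  have : Function.Periodic xiPrim 2 := xiPrim_add_two
  have := this.int_mul l u
  rwa [mul_comm] at this

/-! ### Flatness of the square root of the primitive at its zeros -/

lemma sin_pi_mul_pos {u : ℝ} (hu : u ∈ Ioo (0 : ℝ) (1 / 2)) : 0 < Real.sin (Real.pi * u) :=
  Real.sin_pos_of_pos_of_lt_pi (mul_pos Real.pi_pos hu.1) (by nlinarith [Real.pi_pos, hu.2])

lemma cos_pi_mul_pos {u : ℝ} (hu : u ∈ Ioo (0 : ℝ) (1 / 2)) : 0 < Real.cos (Real.pi * u) :=
  Real.cos_pos_of_mem_Ioo ⟨by nlinarith [Real.pi_pos, hu.1], by nlinarith [Real.pi_pos, hu.2]⟩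

lemma hasDerivAt_sin_pi_mul (u : ℝ) : HasDerivAt (fun u => Real.sin (Real.pi * u))
    (Real.pi * Real.cos (Real.pi * u)) u := by
  simpa [mul_comm] using ((hasDerivAt_id u).const_mul Real.pi).sin

lemma hasDerivAt_cos_pi_mul (u : ℝ) : HasDerivAt (fun u => Real.cos (Real.pi * u))
    (-Real.pi * Real.sin (Real.pi * u)) u := by
  simpa [mul_comm] using ((hasDerivAt_id u).const_mul Real.pi).cos

/-- The flat factor `exp (-1 / (2 sin² (π u)))`. -/
def flat (u : ℝ) : ℝ := Real.exp (-(1 / 2) * (Real.sin (Real.pi * u))⁻¹ ^ 2)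

lemma flat_pos (u : ℝ) : 0 < flat u := Real.exp_pos _

lemma flat_sq (u : ℝ) : flat u ^ 2 = Real.exp (-1 / Real.sin (Real.pi * u) ^ 2) := by
  rw [flat, ← Real.exp_nat_mul]
  congr 1
  push_cast
  ring

lemma xi_eq_flat (u : ℝ) : xi u = Real.sin (Real.pi * u) * flat u ^ 2 := by
  rw [flat_sq, xi]

lemma hasDerivAt_flat {u : ℝ} (hu : u ∈ Ioo (0 : ℝ) (1 / 2)) : HasDerivAt flat
    (flat u * (Real.pi * Real.cos (Real.pi * u) * (Real.sin (Real.pi * u))⁻¹ ^ 3)) u := by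
  have h0 := (sin_pi_mul_pos hu).ne'
  have h := ((((hasDerivAt_sin_pi_mul u).inv h0).pow 2).const_mul (-(1 / 2) : ℝ)).exp
  refine h.congr_deriv ?_
  simp only [flat, Pi.inv_apply, Pi.pow_apply]
  push_cast
  ring

/-- The quotient of the square root of the primitive of `ξ` by the flat factor. -/
def flatQuot (u : ℝ) : ℝ := Real.sqrt (xiPrim u) / flat u

lemma xiPrim_pos_half {u : ℝ} (hu : u ∈ Ioo (0 : ℝ) (1 / 2)) : 0 < xiPrim u :=
  xiPrim_pos hu.1 (by linarith [hu.2])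

lemma flatQuot_pos {u : ℝ} (hu : u ∈ Ioo (0 : ℝ) (1 / 2)) : 0 < flatQuot u :=
  div_pos (Real.sqrt_pos.2 (xiPrim_pos_half hu)) (flat_pos u)

lemma hasDerivAt_flatQuot {u : ℝ} (hu : u ∈ Ioo (0 : ℝ) (1 / 2)) : HasDerivAt flatQuot
    (1 / 2 * Real.sin (Real.pi * u) * (flatQuot u)⁻¹ -
      Real.pi * Real.cos (Real.pi * u) * (Real.sin (Real.pi * u))⁻¹ ^ 3 * flatQuot u) u := by
  have h0 := xiPrim_pos_half hu
  have h1 := (sin_pi_mul_pos hu).ne'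
  have h2 := (flat_pos u).ne'
  have h3 := (Real.sqrt_pos.2 h0).ne'
  have h := ((hasDerivAt_xiPrim u).sqrt h0.ne').div (hasDerivAt_flat hu) h2
  refine h.congr_deriv ?_
  rw [xi_eq_flat, flatQuot]
  field_simp

/-- The primitive of `ξ` is bounded by its value at the right end, where `flat` is largest. -/
lemma flatQuot_le_one {u : ℝ} (hu : u ∈ Ioo (0 : ℝ) (1 / 2)) : flatQuot u ≤ 1 := by
  rw [flatQuot, div_le_one (flat_pos u), Real.sqrt_le_left (flat_pos u).le]
  have key : ∀ τ ∈ uIoc 0 u, ‖xi τ‖ ≤ flat u ^ 2 := by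
    intro τ hτ
    rw [uIoc_of_le hu.1.le] at hτ
    have hτ' : τ ∈ Ioo (0 : ℝ) (1 / 2) := ⟨hτ.1, hτ.2.trans_lt hu.2⟩
    have hs := sin_pi_mul_pos hτ'
    have hle : Real.sin (Real.pi * τ) ≤ Real.sin (Real.pi * u) :=
      Real.sin_le_sin_of_le_of_le_pi_div_two (by nlinarith [Real.pi_pos, hτ'.1])
        (by nlinarith [Real.pi_pos, hu.2]) (by nlinarith [Real.pi_pos, hτ.2])
    have hf : flat τ ^ 2 ≤ flat u ^ 2 := by
      rw [flat_sq, flat_sq, Real.exp_le_exp, neg_div, neg_div, neg_le_neg_iff]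
      gcongr
    rw [xi_eq_flat, Real.norm_of_nonneg (by positivity)]
    nlinarith [Real.sin_le_one (Real.pi * τ), sq_nonneg (flat τ)]
  have := intervalIntegral.norm_integral_le_of_norm_le_const key
  rw [sub_zero, abs_of_pos hu.1] at this
  have h2 : xiPrim u ≤ flat u ^ 2 * u := (le_abs_self _).trans this
  nlinarith [sq_nonneg (flat u), hu.2]

/-- Comparison of the derivatives `ξ` and `(sin⁴ (π u) exp (-1 / sin² (π u)))'`. -/
lemma sin_pow_mul_flat_sq_le {u : ℝ} (hu : u ∈ Ioo (0 : ℝ) (1 / 2)) :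
    Real.sin (Real.pi * u) ^ 4 * flat u ^ 2 ≤ 6 * Real.pi * xiPrim u := by
  set D : ℝ → ℝ := fun u => 6 * Real.pi * xiPrim u -
    Real.sin (Real.pi * u) ^ 4 * expNegInvGlue (Real.sin (Real.pi * u) ^ 2) with hD
  have hglue : ∀ v ∈ Ioo (0 : ℝ) (1 / 2), expNegInvGlue (Real.sin (Real.pi * v) ^ 2) =
      flat v ^ 2 := by
    intro v hv
    have := sin_pi_mul_pos hv
    rw [flat_sq, expNegInvGlue, if_neg (not_le.2 (by positivity)), neg_div, one_div]
  have hder : ∀ v ∈ Ioo (0 : ℝ) (1 / 2), HasDerivAt D (6 * Real.pi * xi v -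
      ((4 * Real.sin (Real.pi * v) ^ 3 * (Real.pi * Real.cos (Real.pi * v))) * flat v ^ 2 +
        Real.sin (Real.pi * v) ^ 4 * (2 * flat v * (flat v *
        (Real.pi * Real.cos (Real.pi * v) * (Real.sin (Real.pi * v))⁻¹ ^ 3))))) v := by
    intro v hv
    have h1 := ((hasDerivAt_sin_pi_mul v).pow 4).mul ((hasDerivAt_flat hv).pow 2)
    have h2 := ((hasDerivAt_xiPrim v).const_mul (6 * Real.pi)).sub h1
    have heq : D =ᶠ[𝓝 v] fun u => 6 * Real.pi * xiPrim u -
        Real.sin (Real.pi * u) ^ 4 * flat u ^ 2 := by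
      filter_upwards [isOpen_Ioo.mem_nhds hv] with w hw
      rw [hD]
      simp only [hglue w hw]
    refine (h2.congr_deriv ?_).congr_of_eventuallyEq heq
    simp only [Pi.pow_apply]
    push_cast
    ring
  have hcont : Continuous D := by
    have h3 : Continuous expNegInvGlue := (expNegInvGlue.contDiff (n := 0)).continuous
    have h4 : Continuous xiPrim := contDiff_xiPrim.continuous
    fun_prop
  have hmono : MonotoneOn D (Icc 0 (1 / 2)) := by
    refine monotoneOn_of_deriv_nonneg (convex_Icc _ _) hcont.continuousOn ?_ ?_
    · rw [interior_Icc]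
      exact fun v hv => (hder v hv).differentiableAt.differentiableWithinAt
    · rw [interior_Icc]
      intro v hv
      rw [(hder v hv).deriv, xi_eq_flat]
      have hs := sin_pi_mul_pos hv
      have hc := cos_pi_mul_pos hv
      have hs1 := Real.sin_le_one (Real.pi * v)
      have hc1 := Real.cos_le_one (Real.pi * v)
      set s := Real.sin (Real.pi * v)
      set k := Real.cos (Real.pi * v)
      have e : 6 * Real.pi * (s * flat v ^ 2) - (4 * s ^ 3 * (Real.pi * k) * flat v ^ 2 +
          s ^ 4 * (2 * flat v * (flat v * (Real.pi * k * s⁻¹ ^ 3)))) =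
          Real.pi * s * flat v ^ 2 * (4 * (1 - s ^ 2 * k) + 2 * (1 - k)) := by
        field_simp
        ring
      rw [e]
      have : s ^ 2 * k ≤ 1 := by
        have : s ^ 2 ≤ 1 := by nlinarith
        nlinarith
      have : 0 ≤ 4 * (1 - s ^ 2 * k) + 2 * (1 - k) := by linarith
      have := Real.pi_pos
      positivity
  have h5 := hmono (left_mem_Icc.2 (by norm_num)) ⟨hu.1.le, hu.2.le⟩ hu.1.le
  simp only [hD, mul_zero, Real.sin_zero, hglue u hu, xiPrim_zero] at h5
  norm_num at h5
  linarith

lemma inv_flatQuot_le {u : ℝ} (hu : u ∈ Ioo (0 : ℝ) (1 / 2)) :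
    (flatQuot u)⁻¹ ≤ Real.sqrt (6 * Real.pi) * (Real.sin (Real.pi * u))⁻¹ ^ 2 := by
  have h1 := sin_pow_mul_flat_sq_le hu
  have hs := sin_pi_mul_pos hu
  have hf := flat_pos u
  have hr := Real.sqrt_pos.2 (xiPrim_pos_half hu)
  have h2 : Real.sin (Real.pi * u) ^ 2 * flat u ≤
      Real.sqrt (6 * Real.pi) * Real.sqrt (xiPrim u) := by
    rw [← Real.sqrt_mul (by positivity)]
    apply Real.le_sqrt_of_sq_le
    calc _ = Real.sin (Real.pi * u) ^ 4 * flat u ^ 2 := by ring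
      _ ≤ _ := h1
  rw [flatQuot, inv_div, div_le_iff₀ hr, inv_pow, mul_right_comm, ← div_eq_mul_inv,
    le_div_iff₀ (by positivity)]
  linarith

/-- The functions on `(0, 1 / 2)` generated by `sin (π u)`, `cos (π u)`, the quotient `flatQuot`
and the inverses of the first and of the last. They are closed under differentiation and grow at
most polynomially in `1 / sin (π u)`. -/
def tame : Subalgebra ℝ (ℝ → ℝ) := Algebra.adjoin ℝ
  {fun u => Real.sin (Real.pi * u), fun u => Real.cos (Real.pi * u),
    fun u => (Real.sin (Real.pi * u))⁻¹, flatQuot, fun u => (flatQuot u)⁻¹}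

lemma sin_mem_tame : (fun u => Real.sin (Real.pi * u)) ∈ tame :=
  Algebra.subset_adjoin (by simp)

lemma cos_mem_tame : (fun u => Real.cos (Real.pi * u)) ∈ tame :=
  Algebra.subset_adjoin (by simp)

lemma inv_sin_mem_tame : (fun u => (Real.sin (Real.pi * u))⁻¹) ∈ tame :=
  Algebra.subset_adjoin (by simp)

lemma flatQuot_mem_tame : flatQuot ∈ tame := Algebra.subset_adjoin (by simp)

lemma inv_flatQuot_mem_tame : (fun u => (flatQuot u)⁻¹) ∈ tame :=
  Algebra.subset_adjoin (by simp)

lemma const_mem_tame (x : ℝ) : (fun _ => x) ∈ tame := tame.algebraMap_mem x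

lemma flat_logDeriv_mem_tame : (fun u => Real.pi * Real.cos (Real.pi * u) *
    (Real.sin (Real.pi * u))⁻¹ ^ 3) ∈ tame :=
  tame.mul_mem (tame.mul_mem (const_mem_tame _) cos_mem_tame) (tame.pow_mem inv_sin_mem_tame 3)

lemma exists_deriv_mem_tame {f : ℝ → ℝ} (hf : f ∈ tame) :
    ∃ f' ∈ tame, ∀ u ∈ Ioo (0 : ℝ) (1 / 2), HasDerivAt f (f' u) u := by
  induction hf using Algebra.adjoin_induction with
  | mem f hf =>
    simp only [mem_insert_iff, mem_singleton_iff] at hf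
    have hr' : (fun u => 1 / 2 * Real.sin (Real.pi * u) * (flatQuot u)⁻¹ -
        Real.pi * Real.cos (Real.pi * u) * (Real.sin (Real.pi * u))⁻¹ ^ 3 * flatQuot u) ∈ tame :=
      tame.sub_mem (tame.mul_mem (tame.mul_mem (const_mem_tame _) sin_mem_tame)
        inv_flatQuot_mem_tame) (tame.mul_mem flat_logDeriv_mem_tame flatQuot_mem_tame)
    rcases hf with rfl | rfl | rfl | rfl | rfl
    · exact ⟨_, tame.mul_mem (const_mem_tame Real.pi) cos_mem_tame,
        fun u _ => hasDerivAt_sin_pi_mul u⟩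
    · exact ⟨_, tame.mul_mem (const_mem_tame (-Real.pi)) sin_mem_tame,
        fun u _ => hasDerivAt_cos_pi_mul u⟩
    · refine ⟨_, tame.mul_mem (tame.mul_mem (const_mem_tame (-Real.pi)) cos_mem_tame)
        (tame.pow_mem inv_sin_mem_tame 2), fun u hu => ?_⟩
      refine ((hasDerivAt_sin_pi_mul u).inv (sin_pi_mul_pos hu).ne').congr_deriv ?_
      simp only [Pi.mul_apply, Pi.pow_apply]
      ring
    · exact ⟨_, hr', fun u hu => hasDerivAt_flatQuot hu⟩
    · refine ⟨_, tame.mul_mem (tame.neg_mem hr') (tame.pow_mem inv_flatQuot_mem_tame 2),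
        fun u hu => ?_⟩
      refine ((hasDerivAt_flatQuot hu).inv (flatQuot_pos hu).ne').congr_deriv ?_
      simp only [Pi.mul_apply, Pi.pow_apply, Pi.neg_apply]
      ring
  | algebraMap r => exact ⟨0, tame.zero_mem, fun u _ => hasDerivAt_const u r⟩
  | add f g _ _ hf hg =>
    obtain ⟨f', hf', hf⟩ := hf
    obtain ⟨g', hg', hg⟩ := hg
    exact ⟨f' + g', tame.add_mem hf' hg', fun u hu => (hf u hu).add (hg u hu)⟩
  | mul f g hfm hgm hf hg =>
    obtain ⟨f', hf', hf⟩ := hf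
    obtain ⟨g', hg', hg⟩ := hg
    exact ⟨f' * g + f * g', tame.add_mem (tame.mul_mem hf' hgm) (tame.mul_mem hfm hg'),
      fun u hu => (hf u hu).mul (hg u hu)⟩

lemma exists_bound_of_mem_tame {f : ℝ → ℝ} (hf : f ∈ tame) :
    ∃ C : ℝ, 0 ≤ C ∧ ∃ k : ℕ, ∀ u ∈ Ioo (0 : ℝ) (1 / 2),
      |f u| ≤ C * (Real.sin (Real.pi * u))⁻¹ ^ k := by
  have one_le : ∀ u ∈ Ioo (0 : ℝ) (1 / 2), 1 ≤ (Real.sin (Real.pi * u))⁻¹ := fun u hu =>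
    (one_le_inv₀ (sin_pi_mul_pos hu)).2 (Real.sin_le_one _)
  induction hf using Algebra.adjoin_induction with
  | mem f hf =>
    simp only [mem_insert_iff, mem_singleton_iff] at hf
    rcases hf with rfl | rfl | rfl | rfl | rfl
    · exact ⟨1, zero_le_one, 0, fun u _ => by simpa using Real.abs_sin_le_one _⟩
    · exact ⟨1, zero_le_one, 0, fun u _ => by simpa using Real.abs_cos_le_one _⟩
    · refine ⟨1, zero_le_one, 1, fun u hu => ?_⟩
      rw [abs_of_pos (inv_pos.2 (sin_pi_mul_pos hu))]
      simp
    · refine ⟨1, zero_le_one, 0, fun u hu => ?_⟩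
      rw [abs_of_pos (flatQuot_pos hu)]
      simpa using flatQuot_le_one hu
    · refine ⟨_, Real.sqrt_nonneg (6 * Real.pi), 2, fun u hu => ?_⟩
      rw [abs_of_pos (inv_pos.2 (flatQuot_pos hu))]
      exact inv_flatQuot_le hu
  | algebraMap r => exact ⟨|r|, abs_nonneg r, 0, fun u _ => by simp⟩
  | add f g _ _ hf hg =>
    obtain ⟨C, hC, k, hf⟩ := hf
    obtain ⟨C', hC', k', hg⟩ := hg
    refine ⟨C + C', add_nonneg hC hC', max k k', fun u hu => ?_⟩
    have h1 := one_le u hu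
    calc |f u + g u| ≤ |f u| + |g u| := abs_add_le _ _
      _ ≤ C * (Real.sin (Real.pi * u))⁻¹ ^ k + C' * (Real.sin (Real.pi * u))⁻¹ ^ k' :=
        add_le_add (hf u hu) (hg u hu)
      _ ≤ C * (Real.sin (Real.pi * u))⁻¹ ^ max k k' +
          C' * (Real.sin (Real.pi * u))⁻¹ ^ max k k' := by
        gcongr <;> simp
      _ = _ := by ring
  | mul f g _ _ hf hg =>
    obtain ⟨C, hC, k, hf⟩ := hf
    obtain ⟨C', hC', k', hg⟩ := hg
    refine ⟨C * C', mul_nonneg hC hC', k + k', fun u hu => ?_⟩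
    have h1 := sin_pi_mul_pos hu
    calc |f u * g u| = |f u| * |g u| := abs_mul _ _
      _ ≤ (C * (Real.sin (Real.pi * u))⁻¹ ^ k) * (C' * (Real.sin (Real.pi * u))⁻¹ ^ k') := by
        gcongr
        · exact hf u hu
        · exact hg u hu
      _ = _ := by ring

/-- The flat factor beats every power of `1 / sin (π u)`. -/
lemma tendsto_flat_mul_inv_pow (k : ℕ) :
    Tendsto (fun u => flat u * (Real.sin (Real.pi * u))⁻¹ ^ k) (𝓝[>] 0) (𝓝 0) := by
  have hs : Tendsto (fun u => (Real.sin (Real.pi * u))⁻¹) (𝓝[>] 0) atTop := by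
    refine tendsto_inv_nhdsGT_zero.comp (tendsto_nhdsWithin_iff.2 ⟨?_, ?_⟩)
    · have h1 : Continuous fun u : ℝ => Real.sin (Real.pi * u) := by fun_prop
      have := h1.tendsto 0
      simp only [mul_zero, Real.sin_zero] at this
      exact this.mono_left nhdsWithin_le_nhds
    · filter_upwards [Ioo_mem_nhdsGT (show (0 : ℝ) < 1 / 2 by norm_num)] with u hu
      exact sin_pi_mul_pos hu
  have h2 : Tendsto (fun x : ℝ => Real.exp (-(1 / 2) * x ^ 2) * x ^ k) atTop (𝓝 0) := by
    have := Real.tendsto_pow_mul_exp_neg_atTop_nhds_zero k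
    refine squeeze_zero' ?_ ?_ this
    · filter_upwards [eventually_ge_atTop 0] with x hx
      positivity
    · filter_upwards [eventually_ge_atTop 2] with x hx
      rw [mul_comm]
      gcongr
      nlinarith
  exact h2.comp hs

/-- The product of the flat factor with `f`, continued by `0` to the left of `0`. -/
def flatCut (f : ℝ → ℝ) (u : ℝ) : ℝ := if 0 < u then flat u * f u else 0

lemma exists_hasDerivAt_flatCut {f : ℝ → ℝ} (hf : f ∈ tame) :
    ∃ f' ∈ tame, ∀ u ∈ Iio (1 / 2 : ℝ), HasDerivAt (flatCut f) (flatCut f' u) u := by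
  obtain ⟨f', hf', hd⟩ := exists_deriv_mem_tame hf
  refine ⟨_, tame.add_mem (tame.mul_mem flat_logDeriv_mem_tame hf) hf', fun u hu => ?_⟩
  rcases lt_trichotomy u 0 with h0 | rfl | h0
  · rw [flatCut, if_neg h0.not_gt]
    refine (hasDerivAt_const u (0 : ℝ)).congr_of_eventuallyEq ?_
    filter_upwards [isOpen_Iio.mem_nhds h0] with v hv
    exact if_neg (not_lt.2 (le_of_lt hv))
  · rw [flatCut, if_neg (lt_irrefl _)]
    obtain ⟨C, hC, k, hb⟩ := exists_bound_of_mem_tame hf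
    rw [hasDerivAt_iff_tendsto_slope, ← Iio_union_Ioi, nhdsWithin_union]
    refine Tendsto.sup ?_ ?_
    · refine tendsto_const_nhds.congr' ?_
      filter_upwards [self_mem_nhdsWithin] with v hv
      rw [slope_def_field, flatCut, flatCut, if_neg (not_lt.2 (le_of_lt hv)),
        if_neg (lt_irrefl _)]
      simp
    · have hlim := (tendsto_flat_mul_inv_pow (k + 1)).const_mul (Real.pi * C)
      rw [mul_zero] at hlim
      refine squeeze_zero_norm' ?_ hlim
      filter_upwards [Ioo_mem_nhdsGT (show (0 : ℝ) < 1 / 2 by norm_num)] with v hv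
      have hs := sin_pi_mul_pos hv
      have hsl : Real.sin (Real.pi * v) ≤ Real.pi * v :=
        Real.sin_le (mul_pos Real.pi_pos hv.1).le
      have hv1 : v⁻¹ ≤ Real.pi * (Real.sin (Real.pi * v))⁻¹ := by
        rw [← div_eq_mul_inv, le_div_iff₀ hs, inv_mul_le_iff₀ hv.1]
        linarith
      have hv0 := hv.1
      rw [slope_def_field, flatCut, flatCut, if_pos hv.1, if_neg (lt_irrefl _), sub_zero,
        sub_zero, Real.norm_eq_abs, abs_div, abs_mul, abs_of_pos hv.1, abs_of_pos (flat_pos v),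
        div_eq_mul_inv]
      calc flat v * |f v| * v⁻¹ ≤ flat v * (C * (Real.sin (Real.pi * v))⁻¹ ^ k) *
            (Real.pi * (Real.sin (Real.pi * v))⁻¹) := by
            have := flat_pos v
            gcongr
            exact hb v hv
        _ = _ := by ring
  · have hu' : u ∈ Ioo (0 : ℝ) (1 / 2) := ⟨h0, hu⟩
    have h := (hasDerivAt_flat hu').mul (hd u hu')
    rw [flatCut, if_pos h0]
    refine (h.congr_deriv ?_).congr_of_eventuallyEq ?_
    · simp only [Pi.add_apply, Pi.mul_apply]
      ring
    · filter_upwards [isOpen_Ioi.mem_nhds h0] with v hv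
      exact if_pos hv

lemma contDiffOn_flatCut (n : ℕ) : ∀ f ∈ tame, ContDiffOn ℝ n (flatCut f) (Iio (1 / 2)) := by
  induction n with
  | zero =>
    intro f hf
    obtain ⟨f', -, h⟩ := exists_hasDerivAt_flatCut hf
    exact contDiffOn_zero.2 fun u hu => (h u hu).continuousAt.continuousWithinAt
  | succ n ih =>
    intro f hf
    obtain ⟨f', hf', h⟩ := exists_hasDerivAt_flatCut hf
    rw [Nat.cast_succ, contDiffOn_succ_iff_deriv_of_isOpen isOpen_Iio]
    refine ⟨fun u hu => (h u hu).differentiableAt.differentiableWithinAt, by simp, ?_⟩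
    exact (ih f' hf').congr fun u hu => (h u hu).deriv

/-! ### The smooth bumps whose translates make up the functions of Blanuša -/

/-- The bump `√(∫_0^u ξ / ∫_0^1 ξ)` on `(0, 2)`, continued by `0`. -/
def bump (u : ℝ) : ℝ := if 0 < u ∧ u < 2 then Real.sqrt (xiPrim u / xiPrim 1) else 0

lemma xiPrim_one_pos : 0 < xiPrim 1 := xiPrim_pos one_pos one_lt_two

lemma bump_two_sub (u : ℝ) : bump (2 - u) = bump u := by
  unfold bump
  rw [xiPrim_two_sub]
  congr 1
  exact propext ⟨fun h => ⟨by linarith [h.2], by linarith [h.1]⟩,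
    fun h => ⟨by linarith [h.2], by linarith [h.1]⟩⟩

lemma bump_of_nonpos {u : ℝ} (h : u ≤ 0) : bump u = 0 := if_neg fun h' => h.not_gt h'.1

lemma bump_of_two_le {u : ℝ} (h : 2 ≤ u) : bump u = 0 := if_neg fun h' => h.not_gt h'.2

lemma bump_eq_flatCut {u : ℝ} (hu : u < 1 / 2) :
    bump u = (Real.sqrt (xiPrim 1))⁻¹ * flatCut flatQuot u := by
  unfold bump flatCut
  split_ifs with h1 h2 h2
  · rw [flatQuot, mul_div_cancel₀ _ (flat_pos u).ne', Real.sqrt_div' _ xiPrim_one_pos.le,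
      div_eq_inv_mul]
  · exact absurd h1.1 h2
  · exact absurd ⟨h2, by linarith⟩ h1
  · simp

lemma contDiff_bump : ContDiff ℝ ∞ bump := by
  have left : ∀ u < (1 / 2 : ℝ), ContDiffAt ℝ ∞ bump u := by
    intro u hu
    have h1 : ContDiffOn ℝ ∞ (flatCut flatQuot) (Iio (1 / 2)) :=
      contDiffOn_infty.2 fun n => contDiffOn_flatCut n _ flatQuot_mem_tame
    have h2 := (h1.contDiffAt (isOpen_Iio.mem_nhds hu))
    refine (contDiffAt_const (c := (Real.sqrt (xiPrim 1))⁻¹).mul h2).congr_of_eventuallyEq ?_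
    filter_upwards [isOpen_Iio.mem_nhds hu] with v hv
    exact bump_eq_flatCut hv
  refine contDiff_iff_contDiffAt.2 fun u => ?_
  rcases lt_or_ge u (1 / 2) with h | h
  · exact left u h
  rcases lt_or_ge u 2 with h' | h'
  · have hmem : u ∈ Ioo (0 : ℝ) 2 := ⟨by linarith, h'⟩
    have h3 : ContDiffAt ℝ ∞ (fun u => Real.sqrt (xiPrim u / xiPrim 1)) u :=
      (contDiff_xiPrim.contDiffAt.div_const _).sqrt
        (div_pos (xiPrim_pos hmem.1 hmem.2) xiPrim_one_pos).ne'
    refine h3.congr_of_eventuallyEq ?_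
    filter_upwards [isOpen_Ioo.mem_nhds hmem] with v hv
    exact if_pos hv
  · have h4 : ContDiffAt ℝ ∞ (fun v => bump (2 - v)) u :=
      ContDiffAt.comp u (left (2 - u) (by linarith)) (contDiffAt_const.sub contDiffAt_id)
    simpa only [bump_two_sub] using h4

lemma deriv_bump_of_two_le {u : ℝ} (h : 2 ≤ u) : deriv bump u = 0 := by
  have hd : DifferentiableAt ℝ bump u :=
    (contDiff_bump.differentiable (by simp)).differentiableAt
  have h1 : HasDerivWithinAt bump (deriv bump u) (Ici u) u := hd.hasDerivAt.hasDerivWithinAt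
  have h2 : HasDerivWithinAt bump 0 (Ici u) u :=
    (hasDerivWithinAt_const u (Ici u) (0 : ℝ)).congr
      (fun v hv => bump_of_two_le (h.trans hv)) (bump_of_two_le h)
  exact (uniqueDiffOn_Ici u u self_mem_Ici).eq_deriv _ h1 h2

lemma psiHat_eq (j : Fin 2) (u : ℝ) :
    psiHat j u = Real.sqrt (xiPrim (u + shift j) / xiPrim 1) := by
  rw [psiHat, ← xiPrim, ← xiPrim, one_div, div_eq_inv_mul]

lemma shift_eq_one_or_zero (j : Fin 2) : shift j = 1 ∨ shift j = 0 := by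
  fin_cases j <;> simp [shift]

/-- On the union of the two adjacent intervals of length `2` whose right one starts at
`2 l + shift j`, the function `psiHat j` is the sum of two bumps. -/
lemma psiHat_eq_bump (j : Fin 2) (l : ℤ) {u : ℝ}
    (hu : u ∈ Ioo (2 * l + shift j - 2) (2 * l + shift j + 2)) :
    psiHat j u = bump (u - (2 * l + shift j)) + bump (u - (2 * l + shift j) + 2) := by
  set v := u - (2 * l + shift j) with hv
  have h1 : xiPrim (u + shift j) = xiPrim v := by
    rcases shift_eq_one_or_zero j with h | h
    · rw [← xiPrim_add_two_mul v (l + 1)]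
      congr 1
      rw [hv, h]
      push_cast
      ring
    · rw [← xiPrim_add_two_mul v l]
      congr 1
      rw [hv, h]
      ring
  rw [psiHat_eq, h1]
  have hv1 : -2 < v := by linarith [hu.1]
  have hv2 : v < 2 := by linarith [hu.2]
  rcases lt_trichotomy v 0 with h | h | h
  · rw [bump_of_nonpos h.le, zero_add, bump, if_pos ⟨by linarith, by linarith⟩, xiPrim_add_two]
  · rw [h, xiPrim_zero, bump_of_nonpos le_rfl, bump_of_two_le (by norm_num)]
    simp
  · rw [bump_of_two_le (u := v + 2) (by linarith), add_zero, bump, if_pos ⟨h, hv2⟩]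

/-- The squares of the two functions of Blanuša add up to `1`. -/
lemma psiHat_sq_add_psiHat_sq (u : ℝ) : psiHat 0 u ^ 2 + psiHat 1 u ^ 2 = 1 := by
  have hnn : ∀ v, 0 ≤ xiPrim v := by
    intro v
    set l := ⌊v / 2⌋
    have h1 := Int.floor_le (v / 2)
    have h2 := Int.lt_floor_add_one (v / 2)
    have h3 := xiPrim_add_two_mul (v - 2 * l) l
    rw [sub_add_cancel] at h3
    rw [h3]
    rcases (show 0 ≤ v - 2 * l by linarith).eq_or_lt with h | h
    · rw [← h, xiPrim_zero]
    · exact (xiPrim_pos h (by linarith)).le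
  have h1 := xiPrim_one_pos
  rw [psiHat_eq, psiHat_eq, Real.sq_sqrt (div_nonneg (hnn _) h1.le),
    Real.sq_sqrt (div_nonneg (hnn _) h1.le), ← add_div, div_eq_one_iff_eq h1.ne']
  have := xiPrim_add_xiPrim_add_one u
  simp only [shift, Matrix.cons_val_zero, Matrix.cons_val_one, add_zero]
  linarith

/-! ### The curve `(T_1, T_2)` of unit speed and bounded first coordinate -/

lemma hasDerivAt_T₁ (u : ℝ) : HasDerivAt T₁ (Real.pi / 4 * (1 / Real.cosh u ^ 2)) u := by
  have h0 := (Real.cosh_pos u).ne'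
  have h := ((((Real.hasDerivAt_sinh u).div (Real.hasDerivAt_cosh u) h0).const_add 1).const_mul
    (Real.pi / 4))
  have e : T₁ = fun u => Real.pi / 4 * (1 + (Real.sinh / Real.cosh) u) := by
    funext v
    rw [T₁, Real.tanh_eq_sinh_div_cosh, Pi.div_apply]
  rw [e]
  refine h.congr_deriv ?_
  congr 2
  linarith [Real.cosh_sq u]

lemma deriv_T₁ : deriv T₁ = fun u => Real.pi / 4 * (1 / Real.cosh u ^ 2) :=
  funext fun u => (hasDerivAt_T₁ u).deriv

lemma contDiff_deriv_T₁ : ContDiff ℝ ∞ (deriv T₁) := by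
  rw [deriv_T₁]
  have h1 : ContDiff ℝ ∞ fun u : ℝ => Real.cosh u ^ 2 := Real.contDiff_cosh.pow 2
  exact contDiff_const.mul (contDiff_const.div h1 fun u => by have := Real.cosh_pos u; positivity)

lemma deriv_T₁_pos (u : ℝ) : 0 < deriv T₁ u := by
  rw [deriv_T₁]
  have := Real.cosh_pos u
  have := Real.pi_pos
  positivity

lemma deriv_T₁_lt_one (u : ℝ) : deriv T₁ u < 1 := by
  rw [deriv_T₁]
  have h1 : 1 / Real.cosh u ^ 2 ≤ 1 := by
    have := Real.one_le_cosh u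
    rw [div_le_one (by positivity)]
    nlinarith
  have := Real.pi_lt_d2
  have := Real.pi_pos
  nlinarith

lemma one_sub_deriv_T₁_sq_pos (u : ℝ) : 0 < 1 - deriv T₁ u ^ 2 := by
  nlinarith [deriv_T₁_pos u, deriv_T₁_lt_one u]

lemma contDiff_sqrt_one_sub : ContDiff ℝ ∞ fun u => Real.sqrt (1 - deriv T₁ u ^ 2) :=
  (contDiff_const.sub (contDiff_deriv_T₁.pow 2)).sqrt fun u => (one_sub_deriv_T₁_sq_pos u).ne'

lemma hasDerivAt_T₂ (u : ℝ) : HasDerivAt T₂ (Real.sqrt (1 - deriv T₁ u ^ 2)) u :=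
  intervalIntegral.integral_hasDerivAt_right
    (contDiff_sqrt_one_sub.continuous.intervalIntegrable _ _)
    (contDiff_sqrt_one_sub.continuous.stronglyMeasurableAtFilter _ _)
    contDiff_sqrt_one_sub.continuous.continuousAt

lemma contDiff_T (i : Fin 2) : ContDiff ℝ ∞ (T i) := by
  fin_cases i
  · exact contDiff_infty_iff_deriv.2
      ⟨fun u => (hasDerivAt_T₁ u).differentiableAt, contDiff_deriv_T₁⟩
  · refine contDiff_infty_iff_deriv.2 ⟨fun u => (hasDerivAt_T₂ u).differentiableAt, ?_⟩
    have h : deriv T₂ = fun u => Real.sqrt (1 - deriv T₁ u ^ 2) :=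
      funext fun u => (hasDerivAt_T₂ u).deriv
    change ContDiff ℝ ∞ (deriv T₂)
    rw [h]
    exact contDiff_sqrt_one_sub

lemma hasDerivAt_T (i : Fin 2) (u : ℝ) : HasDerivAt (T i) (deriv (T i) u) u :=
  ((contDiff_T i).differentiable (by simp)).differentiableAt.hasDerivAt

lemma deriv_T_sq_add_deriv_T_sq (u : ℝ) : deriv (T 0) u ^ 2 + deriv (T 1) u ^ 2 = 1 := by
  have h1 : deriv (T 1) u = Real.sqrt (1 - deriv T₁ u ^ 2) := (hasDerivAt_T₂ u).deriv
  have h0 : deriv (T 0) u = deriv T₁ u := rfl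
  rw [h0, h1, Real.sq_sqrt (one_sub_deriv_T₁_sq_pos u).le]
  ring

/-- The values of `T_1` lie in `(0, π / 2)`, so that they can be read off from the tangent. -/
lemma arctan_T₁ (u : ℝ) : Real.arctan (Real.sin (T₁ u) / Real.cos (T₁ u)) = T₁ u := by
  have h1 := Real.tanh_lt_one u
  have h2 := Real.neg_one_lt_tanh u
  have hpi := Real.pi_pos
  rw [← Real.tan_eq_sin_div_cos, Real.arctan_tan (by unfold T₁; nlinarith)
    (by unfold T₁; nlinarith)]

lemma strictMono_T₁ : StrictMono T₁ := strictMono_of_deriv_pos deriv_T₁_pos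

lemma cos_T₁_pos (u : ℝ) : 0 < Real.cos (T₁ u) := by
  have h1 := Real.tanh_lt_one u
  have h2 := Real.neg_one_lt_tanh u
  have hpi := Real.pi_pos
  exact Real.cos_pos_of_mem_Ioo ⟨by unfold T₁; nlinarith, by unfold T₁; nlinarith⟩

/-! ### Integrals with a moving end point -/

section primitive

variable {I : Set ℝ} {w : ℝ → ℝ} {t₀ t : ℝ}

lemma hasDerivAt_integral_sqrt (hI : IsOpen I) (hc : I.OrdConnected) (ht₀ : t₀ ∈ I)
    (hw : ContinuousOn w I) (ht : t ∈ I) :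
    HasDerivAt (fun t => ∫ τ in t₀..t, Real.sqrt (w τ)) (Real.sqrt (w t)) t := by
  have hs : ContinuousOn (fun τ => Real.sqrt (w τ)) I := hw.sqrt
  refine intervalIntegral.integral_hasDerivAt_right
    (hs.mono (hc.uIcc_subset ht₀ ht)).intervalIntegrable
    (hs.stronglyMeasurableAtFilter hI t ht) (hs.continuousAt (hI.mem_nhds ht))

lemma contDiffOn_integral_sqrt (hI : IsOpen I) (hc : I.OrdConnected) (ht₀ : t₀ ∈ I)
    (hw : ContDiffOn ℝ ∞ w I) (hpos : ∀ t ∈ I, 0 < w t) :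
    ContDiffOn ℝ ∞ (fun t => ∫ τ in t₀..t, Real.sqrt (w τ)) I := by
  refine (contDiffOn_infty_iff_deriv_of_isOpen hI).2 ⟨fun t ht =>
    (hasDerivAt_integral_sqrt hI hc ht₀ hw.continuousOn ht).differentiableAt.differentiableWithinAt,
    ?_⟩
  exact (hw.sqrt fun t ht => (hpos t ht).ne').congr fun t ht =>
    (hasDerivAt_integral_sqrt hI hc ht₀ hw.continuousOn ht).deriv

lemma strictMonoOn_integral_sqrt (hI : IsOpen I) (hc : I.OrdConnected) (ht₀ : t₀ ∈ I)
    (hw : ContinuousOn w I) (hpos : ∀ t ∈ I, 0 < w t) :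
    StrictMonoOn (fun t => ∫ τ in t₀..t, Real.sqrt (w τ)) I := by
  refine strictMonoOn_of_deriv_pos hc.convex (fun t ht =>
    (hasDerivAt_integral_sqrt hI hc ht₀ hw ht).continuousAt.continuousWithinAt) fun t ht => ?_
  rw [(hasDerivAt_integral_sqrt hI hc ht₀ hw (interior_subset ht)).deriv]
  exact Real.sqrt_pos.2 (hpos t (interior_subset ht))

end primitive

/-! ### Smoothness across the jumps of the step functions -/

section blocks

variable {I : Set ℝ} {m : ℕ} (D : Choices I) (a : ℕ) (η : Fin m → ℝ → ℝ)

/-- At a jump of the step function `S_j` the function `ψ_j` vanishes to infinite order.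
This is expressed by splitting `ψ_j` near `t₀` into two smooth functions, each of which sees
only one value of `S_j`; the one that does not see `S_j(t₀)` is flat at `t₀`. -/
lemma exists_local_splitting (hI : IsOpen I) (j : Fin 2) {t₀ : ℝ} (ht₀ : t₀ ∈ I) :
    ∃ P Q : ℝ → ℝ, ∃ s : ℝ, ContDiffAt ℝ ∞ P t₀ ∧ ContDiffAt ℝ ∞ Q t₀ ∧
      Q t₀ = 0 ∧ deriv Q t₀ = 0 ∧ ∀ᶠ t in 𝓝 t₀, t ∈ I ∧ ∀ Z : ℝ → ℝ,
        psi D j t * Z (D.S j t) = P t * Z (D.S j t₀) + Q t * Z s := by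
  set l := ⌊(D.γ t₀ - shift j) / 2⌋
  have hl1 : 2 * l + shift j ≤ D.γ t₀ := by
    have := Int.floor_le ((D.γ t₀ - shift j) / 2)
    linarith
  have hl2 : D.γ t₀ < 2 * l + shift j + 2 := by
    have := Int.lt_floor_add_one ((D.γ t₀ - shift j) / 2)
    linarith
  obtain ⟨t₁, ht₁, hγ₁⟩ : 2 * (l : ℝ) + shift j - 2 ∈ D.γ '' I := by
    rw [D.γ_surj]; trivial
  have hγ : ContDiffAt ℝ ∞ D.γ t₀ := D.γ_smooth.contDiffAt (hI.mem_nhds ht₀)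
  have hin : ContDiffAt ℝ ∞ (fun t => D.γ t - (2 * l + shift j) + 2) t₀ :=
    (hγ.sub contDiffAt_const).add contDiffAt_const
  refine ⟨fun t => bump (D.γ t - (2 * l + shift j)),
    fun t => bump (D.γ t - (2 * l + shift j) + 2), D.S j t₁,
    contDiff_bump.contDiffAt.comp t₀ (hγ.sub contDiffAt_const),
    contDiff_bump.contDiffAt.comp t₀ hin, bump_of_two_le (by linarith), ?_, ?_⟩
  · have h1 := ((contDiff_bump.differentiable (by simp)).differentiableAt
      (x := D.γ t₀ - (2 * l + shift j) + 2)).hasDerivAt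
    rw [deriv_bump_of_two_le (by linarith)] at h1
    have h2 := h1.comp t₀ (hin.differentiableAt (by simp)).hasDerivAt
    rw [zero_mul] at h2
    exact h2.deriv
  · have hnear : ∀ᶠ t in 𝓝 t₀, D.γ t ∈ Ioo (2 * l + shift j - 2) (2 * l + shift j + 2) :=
      hγ.continuousAt.eventually_mem (isOpen_Ioo.mem_nhds ⟨by linarith, hl2⟩)
    filter_upwards [hnear, hI.mem_nhds ht₀] with t ht htI
    refine ⟨htI, fun Z => ?_⟩
    rw [psi, psiHat_eq_bump j l ht]
    rcases lt_or_ge (D.γ t) (2 * l + shift j) with h | h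
    · rw [bump_of_nonpos (u := D.γ t - (2 * l + shift j)) (by linarith),
        D.S_step j (l - 1) t htI t₁ ht₁ ⟨by push_cast; linarith [ht.1], by push_cast; linarith⟩
          ⟨by push_cast; linarith, by push_cast; linarith⟩]
      ring
    · rw [bump_of_two_le (u := D.γ t - (2 * l + shift j) + 2) (by linarith),
        D.S_step j l t htI t₀ ht₀ ⟨h, ht.2⟩ ⟨hl1, hl2⟩]
      ring

/-- The quotient `ψ_j / S_j`. -/
def chi (j : Fin 2) (t : ℝ) : ℝ := psi D j t / D.S j t

lemma contDiffOn_psi (hI : IsOpen I) (j : Fin 2) : ContDiffOn ℝ ∞ (psi D j) I := by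
  intro t₀ ht₀
  obtain ⟨P, Q, s, hP, hQ, -, -, h⟩ := exists_local_splitting D hI j ht₀
  refine ((hP.add hQ).congr_of_eventuallyEq ?_).contDiffWithinAt
  filter_upwards [h] with t ht
  simpa using ht.2 fun _ => 1

lemma contDiffOn_chi (hI : IsOpen I) (j : Fin 2) : ContDiffOn ℝ ∞ (chi D j) I := by
  intro t₀ ht₀
  obtain ⟨P, Q, s, hP, hQ, -, -, h⟩ := exists_local_splitting D hI j ht₀
  refine (((hP.mul (contDiffAt_const (c := (D.S j t₀)⁻¹))).add
    (hQ.mul (contDiffAt_const (c := s⁻¹)))).congr_of_eventuallyEq ?_).contDiffWithinAt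
  filter_upwards [h] with t ht
  exact ht.2 fun σ => σ⁻¹

/-- One coordinate of a rotating block is smooth. The step function may jump, but the amplitude
is flat there. -/
lemma contDiffOn_rotating (hI : IsOpen I) (j : Fin 2) {R : ℝ → ℝ} (hR : ContDiffOn ℝ ∞ R I)
    {G : ℝ → ℝ} (hG : ContDiff ℝ ∞ G) (r : Fin m) :
    ContDiffOn ℝ ∞ (fun p : ℝ × (Fin m → ℝ) =>
      R p.1 * (psi D j p.1 / D.S j p.1 * G (D.S j p.1 * p.2 r))) (domain I m) := by
  rintro p ⟨hp, -⟩
  obtain ⟨P, Q, s, hP, hQ, -, -, h⟩ := exists_local_splitting D hI j hp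
  have hR' : ContDiffAt ℝ ∞ (fun q : ℝ × (Fin m → ℝ) => R q.1) p :=
    (hR.contDiffAt (hI.mem_nhds hp)).comp p contDiffAt_fst
  have hP' : ContDiffAt ℝ ∞ (fun q : ℝ × (Fin m → ℝ) => P q.1) p := hP.comp p contDiffAt_fst
  have hQ' : ContDiffAt ℝ ∞ (fun q : ℝ × (Fin m → ℝ) => Q q.1) p := hQ.comp p contDiffAt_fst
  have hx : ContDiff ℝ ∞ fun q : ℝ × (Fin m → ℝ) => q.2 r := by fun_prop
  have hZ : ∀ σ : ℝ, ContDiffAt ℝ ∞ (fun q : ℝ × (Fin m → ℝ) => σ⁻¹ * G (σ * q.2 r)) p :=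
    fun σ => (contDiff_const.mul (hG.comp (contDiff_const.mul hx))).contDiffAt
  refine ((hR'.mul ((hP'.mul (hZ (D.S j p.1))).add (hQ'.mul (hZ s)))).congr_of_eventuallyEq
    ?_).contDiffWithinAt
  filter_upwards [continuousAt_fst.eventually h] with q hq
  have := hq.2 fun σ => σ⁻¹ * G (σ * q.2 r)
  rw [← this]
  ring

lemma hasFDerivAt_fst_mul_comp {E : Type*} [NormedAddCommGroup E] [NormedSpace ℝ E] {R G : ℝ → ℝ}
    {Y : ℝ × E → ℝ} {R' G' : ℝ} {L : ℝ × E →L[ℝ] ℝ} {p : ℝ × E} (hR : HasDerivAt R R' p.1)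
    (hY : HasFDerivAt Y L p) (hG : HasDerivAt G G' (Y p)) :
    HasFDerivAt (fun q => R q.1 * G (Y q))
      ((R' * G (Y p)) • ContinuousLinearMap.fst ℝ ℝ E + (R p.1 * G') • L) p := by
  have h1 : HasFDerivAt (fun q : ℝ × E => R q.1) (R' • ContinuousLinearMap.fst ℝ ℝ E) p :=
    hR.comp_hasFDerivAt p hasFDerivAt_fst
  have h2 : HasFDerivAt (fun q => G (Y q)) (G' • L) p := hG.comp_hasFDerivAt p hY
  refine (h1.mul h2).congr_fderiv ?_
  ext v <;> simp <;> ring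

lemma hasFDerivAt_snd_apply (r : Fin m) (p : ℝ × (Fin m → ℝ)) :
    HasFDerivAt (fun q : ℝ × (Fin m → ℝ) => q.2 r)
      ((ContinuousLinearMap.proj r).comp (ContinuousLinearMap.snd ℝ ℝ (Fin m → ℝ))) p :=
  ((ContinuousLinearMap.proj (R := ℝ) (φ := fun _ : Fin m => ℝ) r).comp
    (ContinuousLinearMap.snd ℝ ℝ (Fin m → ℝ))).hasFDerivAt

/-- One coordinate of a rotating block has the derivative it would have for a constant step
function, even at the jumps, where both are `0`. -/
lemma fderiv_rotating (hI : IsOpen I) (j : Fin 2) {R : ℝ → ℝ} (hR : ContDiffOn ℝ ∞ R I)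
    {G : ℝ → ℝ} (hG : Differentiable ℝ G) (r : Fin m) {p : ℝ × (Fin m → ℝ)} (hp : p.1 ∈ I)
    (v : ℝ × (Fin m → ℝ)) :
    fderiv ℝ (fun p : ℝ × (Fin m → ℝ) =>
      R p.1 * (psi D j p.1 / D.S j p.1 * G (D.S j p.1 * p.2 r))) p v =
      deriv (fun t => R t * psi D j t) p.1 / D.S j p.1 * G (D.S j p.1 * p.2 r) * v.1 +
        R p.1 * psi D j p.1 * deriv G (D.S j p.1 * p.2 r) * v.2 r := by
  obtain ⟨P, Q, s, hP, hQ, hQ0, hQ0', h⟩ := exists_local_splitting D hI j hp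
  have hR' := ((hR.contDiffAt (hI.mem_nhds hp)).differentiableAt (by simp)).hasDerivAt
  have hA := hR'.mul (hP.differentiableAt (by simp)).hasDerivAt
  have hB := hR'.mul (hQ.differentiableAt (by simp)).hasDerivAt
  rw [hQ0, hQ0', mul_zero, mul_zero, add_zero] at hB
  have hψ : HasDerivAt (fun t => R t * psi D j t) _ p.1 := (hA.add hB).congr_of_eventuallyEq (by
    filter_upwards [h] with t ht
    have := ht.2 fun _ => 1
    simp only [mul_one] at this
    simp only [this, Pi.mul_apply, Pi.add_apply]
    ring)
  have hψ0 : psi D j p.1 = P p.1 := by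
    have := h.self_of_nhds.2 fun _ => 1
    simpa [hQ0] using this
  have hZ : ∀ σ : ℝ, HasDerivAt (fun y => σ⁻¹ * G (σ * y))
      (σ⁻¹ * (deriv G (σ * p.2 r) * (σ * 1))) (p.2 r) := fun σ =>
    (((hG (σ * p.2 r)).hasDerivAt).comp (p.2 r)
      ((hasDerivAt_id (p.2 r)).const_mul σ)).const_mul σ⁻¹
  have hF := (hasFDerivAt_fst_mul_comp hA (hasFDerivAt_snd_apply r p) (hZ (D.S j p.1))).add
    (hasFDerivAt_fst_mul_comp hB (hasFDerivAt_snd_apply r p) (hZ s))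
  have hF' := hF.congr_of_eventuallyEq (f₁ := fun p : ℝ × (Fin m → ℝ) =>
      R p.1 * (psi D j p.1 / D.S j p.1 * G (D.S j p.1 * p.2 r))) (by
    filter_upwards [continuousAt_fst.eventually h] with q hq
    have := hq.2 fun σ => σ⁻¹ * G (σ * q.2 r)
    simp only [Pi.mul_apply, Pi.add_apply]
    linear_combination R q.1 * this)
  have hS := (D.S_pos j p.1 hp).ne'
  rw [hF'.fderiv, hψ.deriv, hψ0]
  simp only [Pi.mul_apply, hQ0, add_apply, smul_apply,
    ContinuousLinearMap.coe_fst', ContinuousLinearMap.comp_apply, ContinuousLinearMap.coe_snd',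
    ContinuousLinearMap.proj_apply, smul_eq_mul]
  field_simp
  ring

lemma deriv_mul_chi (hI : IsOpen I) (j : Fin 2) {R : ℝ → ℝ} (hR : ContDiffOn ℝ ∞ R I) {t : ℝ}
    (ht : t ∈ I) :
    deriv (fun s => R s * chi D j s) t = deriv (fun s => R s * psi D j s) t / D.S j t := by
  obtain ⟨P, Q, s, hP, hQ, hQ0, hQ0', h⟩ := exists_local_splitting D hI j ht
  have hR' := ((hR.contDiffAt (hI.mem_nhds ht)).differentiableAt (by simp)).hasDerivAt
  have hA := hR'.mul (hP.differentiableAt (by simp)).hasDerivAt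
  have hB := hR'.mul (hQ.differentiableAt (by simp)).hasDerivAt
  rw [hQ0, hQ0', mul_zero, mul_zero, add_zero] at hB
  have key : ∀ Z : ℝ → ℝ, deriv (fun s => R s * (psi D j s * Z (D.S j s))) t =
      (deriv R t * P t + R t * deriv P t) * Z (D.S j t) := by
    intro Z
    have h1 := (hA.mul_const (Z (D.S j t))).add (hB.mul_const (Z s))
    rw [zero_mul, add_zero] at h1
    refine (h1.congr_of_eventuallyEq ?_).deriv
    filter_upwards [h] with q hq
    simp only [Pi.mul_apply, Pi.add_apply, hq.2 Z]
    ring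
  have h1 := key fun _ => 1
  simp only [mul_one] at h1
  rw [h1]
  exact key fun σ => σ⁻¹

variable {η}

lemma alpha_eq (t : ℝ) : alpha D a η t = ∑ q : Hi m a × Fin 2, (η q.1 t * chi D q.2 t) ^ 2 := by
  rw [Fintype.sum_prod_type, alpha]
  refine Finset.sum_congr rfl fun r _ => Finset.sum_congr rfl fun j _ => ?_
  rw [chi]
  ring

lemma epsSq_eq (hI : IsOpen I) (hη : ∀ j, ContDiffOn ℝ ∞ (η j) I) {t : ℝ} (ht : t ∈ I) :
    epsSq D a η t =
      ∑ q : Hi m a × Fin 2, deriv (fun s => η q.1 s * chi D q.2 s) t ^ 2 := by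
  rw [Fintype.sum_prod_type, epsSq]
  refine Finset.sum_congr rfl fun r _ => Finset.sum_congr rfl fun j _ => ?_
  simp only
  rw [deriv_mul_chi D hI j (hη r) ht, div_pow]

lemma contDiffOn_mul_chi (hI : IsOpen I) (hη : ∀ j, ContDiffOn ℝ ∞ (η j) I)
    (r : Fin m) (j : Fin 2) : ContDiffOn ℝ ∞ (fun s => η r s * chi D j s) I :=
  (hη r).mul (contDiffOn_chi D hI j)

lemma contDiffOn_alpha (hI : IsOpen I) (hη : ∀ j, ContDiffOn ℝ ∞ (η j) I) :
    ContDiffOn ℝ ∞ (alpha D a η) I := by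
  rw [show alpha D a η = _ from funext (alpha_eq D a)]
  exact ContDiffOn.sum fun q _ => (contDiffOn_mul_chi D hI hη q.1 q.2).pow 2

lemma contDiffOn_epsSq (hI : IsOpen I) (hη : ∀ j, ContDiffOn ℝ ∞ (η j) I) :
    ContDiffOn ℝ ∞ (epsSq D a η) I := by
  refine ContDiffOn.congr ?_ fun t ht => epsSq_eq D a hI hη ht
  exact ContDiffOn.sum fun q _ => (((contDiffOn_infty_iff_deriv_of_isOpen hI).1
    (contDiffOn_mul_chi D hI hη q.1 q.2)).2).pow 2

lemma contDiffOn_loSq (hη : ∀ j, ContDiffOn ℝ ∞ (η j) I) : ContDiffOn ℝ ∞ (loSq a η) I :=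
  ContDiffOn.sum fun k _ => (hη k).pow 2

lemma contDiffOn_loDerivSq (hI : IsOpen I) (hη : ∀ j, ContDiffOn ℝ ∞ (η j) I) :
    ContDiffOn ℝ ∞ (loDerivSq a η) I :=
  ContDiffOn.sum fun k _ => (((contDiffOn_infty_iff_deriv_of_isOpen hI).1 (hη k)).2).pow 2

lemma alpha_nonneg (t : ℝ) : 0 ≤ alpha D a η t := by
  rw [alpha_eq]
  exact Finset.sum_nonneg fun q _ => sq_nonneg _

lemma loSq_nonneg (t : ℝ) : 0 ≤ loSq a η t := Finset.sum_nonneg fun _ _ => sq_nonneg _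

lemma hasDerivAt_of_contDiffOn (hI : IsOpen I) {f : ℝ → ℝ} (hf : ContDiffOn ℝ ∞ f I) {t : ℝ}
    (ht : t ∈ I) : HasDerivAt f (deriv f t) t :=
  ((hf.contDiffAt (hI.mem_nhds ht)).differentiableAt (by simp)).hasDerivAt

/-- Cauchy-Schwarz for the derivative of a sum of squares. -/
lemma sq_deriv_sum_sq_le {ι : Type*} (s : Finset ι) {f : ι → ℝ → ℝ} {t : ℝ}
    (hf : ∀ i, DifferentiableAt ℝ (f i) t) :
    deriv (fun x => ∑ i ∈ s, f i x ^ 2) t ^ 2 ≤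
      4 * (∑ i ∈ s, f i t ^ 2) * ∑ i ∈ s, deriv (f i) t ^ 2 := by
  have h1 : HasDerivAt (fun x => ∑ i ∈ s, f i x ^ 2) (∑ i ∈ s, 2 * (f i t * deriv (f i) t)) t :=
    HasDerivAt.fun_sum fun i _ => ((hf i).hasDerivAt.fun_pow 2).congr_deriv (by push_cast; ring)
  rw [h1.deriv, ← Finset.mul_sum]
  have := Finset.sum_mul_sq_le_sq_mul_sq s (fun i => f i t) fun i => deriv (f i) t
  nlinarith

lemma sq_deriv_alpha_le (hI : IsOpen I) (hη : ∀ j, ContDiffOn ℝ ∞ (η j) I) {t : ℝ} (ht : t ∈ I) :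
    deriv (alpha D a η) t ^ 2 ≤ 4 * alpha D a η t * epsSq D a η t := by
  rw [epsSq_eq D a hI hη ht, show alpha D a η = _ from funext (alpha_eq D a)]
  exact sq_deriv_sum_sq_le _ fun q =>
    (hasDerivAt_of_contDiffOn hI (contDiffOn_mul_chi D hI hη q.1 q.2) ht).differentiableAt

lemma sq_deriv_loSq_le (hI : IsOpen I) (hη : ∀ j, ContDiffOn ℝ ∞ (η j) I) {t : ℝ} (ht : t ∈ I) :
    deriv (loSq a η) t ^ 2 ≤ 4 * loSq a η t * loDerivSq a η t :=
  sq_deriv_sum_sq_le Finset.univ (f := fun k : Lo m a => η k) fun k =>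
    (hasDerivAt_of_contDiffOn hI (hη k) ht).differentiableAt

lemma epsSq_nonneg (t : ℝ) : 0 ≤ epsSq D a η t :=
  Finset.sum_nonneg fun r _ => Finset.sum_nonneg fun j _ => by positivity

end blocks

/-! ### The auxiliary choices -/

/-- There is an increasing function on `I` which, added to the identity, takes arbitrarily small
values to the left of every point: `0` if `I` is unbounded below, and `-1 / (t - inf I)`
otherwise. -/
lemma exists_lower_barrier {I : Set ℝ} (hI : IsOpen I) (hc : I.OrdConnected) (hne : I.Nonempty) :
    ∃ b : ℝ → ℝ, ContDiffOn ℝ ∞ b I ∧ (∀ t ∈ I, 0 ≤ deriv b t) ∧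
      (∀ t₀ ∈ I, ∀ y : ℝ, ∃ t ∈ I, t ≤ t₀ ∧ t + b t ≤ y) := by
  by_cases hb : BddBelow I
  · set x := sInf I with hx
    have hlt : ∀ t ∈ I, x < t := by
      intro t ht
      refine lt_of_le_of_ne (csInf_le hb ht) ?_
      rintro rfl
      obtain ⟨ε, hε, hball⟩ := Metric.isOpen_iff.1 hI _ ht
      have h1 : x - ε / 2 ∈ I := hball (by
        rw [Metric.mem_ball, Real.dist_eq, sub_sub_cancel_left, abs_neg, abs_of_pos] <;> linarith)
      linarith [csInf_le hb h1]
    have hder : ∀ t ∈ I, HasDerivAt (fun t => -(t - x)⁻¹) ((t - x)⁻¹ ^ 2) t := by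
      intro t ht
      have h0 : t - x ≠ 0 := (sub_pos.2 (hlt t ht)).ne'
      refine ((((hasDerivAt_id t).sub_const x).inv h0).neg).congr_deriv ?_
      rw [neg_div, neg_neg, one_div, inv_pow]
      rfl
    refine ⟨fun t => -(t - x)⁻¹, ?_, ?_, ?_⟩
    · exact ((contDiffOn_id.sub contDiffOn_const).inv fun t ht => (sub_pos.2 (hlt t ht)).ne').neg
    · intro t ht
      rw [(hder t ht).deriv]
      positivity
    · intro t₀ ht₀ y
      set δ := min (t₀ - x) (|t₀ - y| + 1)⁻¹
      have hδ : 0 < δ := lt_min (sub_pos.2 (hlt t₀ ht₀)) (by positivity)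
      obtain ⟨t₁, ht₁, hlt₁⟩ := exists_lt_of_csInf_lt hne (show sInf I < x + δ by linarith)
      have hle : x + δ ≤ t₀ := by linarith [min_le_left (t₀ - x) (|t₀ - y| + 1)⁻¹]
      refine ⟨x + δ, hc.out ht₁ ht₀ ⟨hlt₁.le, hle⟩, hle, ?_⟩
      have h2 : |t₀ - y| + 1 ≤ δ⁻¹ := by
        rw [← inv_inv (|t₀ - y| + 1)]
        exact inv_anti₀ hδ (min_le_right _ _)
      simp only [add_sub_cancel_left]
      linarith [le_abs_self (t₀ - y)]
  · refine ⟨fun _ => 0, contDiffOn_const, by simp, fun t₀ ht₀ y => ?_⟩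
    rw [not_bddBelow_iff] at hb
    obtain ⟨t, ht, h⟩ := hb (min t₀ y)
    exact ⟨t, ht, h.le.trans (min_le_left _ _), by simpa using h.le.trans (min_le_right _ _)⟩

/-- Every nonempty open interval is diffeomorphic to the real line: correct the identity by a
barrier at each end, the one at the upper end coming from reflection. -/
lemma exists_diffeomorphism {I : Set ℝ} (hI : IsOpen I) (hc : I.OrdConnected) (hne : I.Nonempty) :
    ∃ γ : ℝ → ℝ, ContDiffOn ℝ ∞ γ I ∧ (∀ t ∈ I, 0 < deriv γ t) ∧ γ '' I = univ := by
  have hcn : (-I).OrdConnected := ⟨fun x hx y hy z hz =>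
    hc.out (mem_neg.1 hy) (mem_neg.1 hx) ⟨neg_le_neg hz.2, neg_le_neg hz.1⟩⟩
  have hmono : ∀ {J : Set ℝ}, IsOpen J → J.OrdConnected → ∀ {f : ℝ → ℝ}, ContDiffOn ℝ ∞ f J →
      (∀ t ∈ J, 0 ≤ deriv f t) → MonotoneOn f J := by
    intro J hJ hJc f hf hf'
    refine monotoneOn_of_deriv_nonneg hJc.convex hf.continuousOn ?_ ?_
    · exact (hf.differentiableOn (by simp)).mono interior_subset
    · exact fun t ht => hf' t (interior_subset ht)
  obtain ⟨b, hb, hb', hbs⟩ := exists_lower_barrier hI hc hne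
  obtain ⟨d, hd, hd', hds⟩ := exists_lower_barrier hI.neg hcn hne.neg
  have hbm := hmono hI hc hb hb'
  have hdm := hmono hI.neg hcn hd hd'
  have hmaps : MapsTo (fun t : ℝ => -t) I (-I) := fun t ht => by simpa using ht
  have hdn : ContDiffOn ℝ ∞ (fun t => d (-t)) I := hd.comp contDiffOn_id.neg hmaps
  have hγ : ContDiffOn ℝ ∞ (fun t => t + b t - d (-t)) I := (contDiffOn_id.add hb).sub hdn
  refine ⟨fun t => t + b t - d (-t), hγ, ?_, ?_⟩
  · intro t ht
    have h1 := hasDerivAt_of_contDiffOn hI hb ht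
    have h2 := (hasDerivAt_of_contDiffOn hI.neg hd (hmaps ht)).comp t (hasDerivAt_neg t)
    have h3 : HasDerivAt (fun t => t + b t - d (-t)) _ t := ((hasDerivAt_id t).add h1).sub h2
    rw [h3.deriv]
    have := hb' t ht
    have := hd' (-t) (hmaps ht)
    linarith
  · refine eq_univ_of_forall fun y => ?_
    obtain ⟨t₀, ht₀⟩ := hne
    obtain ⟨t, ht, htt, hty⟩ := hbs t₀ ht₀ (y + d (-t₀))
    obtain ⟨s, hs, hst, hsy⟩ := hds (-t₀) (hmaps ht₀) (-y + b t₀)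
    have hsI : -s ∈ I := hs
    have hord := (hc.isPreconnected.image _ hγ.continuousOn).ordConnected
    refine hord.out (mem_image_of_mem _ ht) (mem_image_of_mem _ hsI) ⟨?_, ?_⟩
    · have := hdm (hmaps ht₀) (hmaps ht) (neg_le_neg htt)
      simp only at this ⊢
      linarith
    · have := hbm ht₀ hsI (by linarith)
      simp only [neg_neg]
      linarith

/-- A step function may be chosen larger than a given continuous function, as its steps are
relatively compact in the interval. -/
lemma exists_step_function {I : Set ℝ} (hc : I.OrdConnected) {γ : ℝ → ℝ} (hγ : StrictMonoOn γ I)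
    (hsurj : γ '' I = univ) {C : ℝ → ℝ} (hC : ContinuousOn C I) (σ : ℝ) :
    ∃ S : ℝ → ℝ, (∀ t, 1 ≤ S t) ∧ (∀ t ∈ I, C t ≤ S t) ∧
      ∀ l : ℤ, ∀ t t', γ t ∈ Ico (2 * l + σ) (2 * l + σ + 2) →
        γ t' ∈ Ico (2 * l + σ) (2 * l + σ + 2) → S t = S t' := by
  have key : ∀ l : ℤ, ∃ M : ℝ, 1 ≤ M ∧
      ∀ t ∈ I, γ t ∈ Icc (2 * l + σ) (2 * l + σ + 2) → C t ≤ M := by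
    intro l
    obtain ⟨t₁, ht₁, h₁⟩ : (2 * l + σ : ℝ) ∈ γ '' I := by rw [hsurj]; trivial
    obtain ⟨t₂, ht₂, h₂⟩ : (2 * l + σ + 2 : ℝ) ∈ γ '' I := by rw [hsurj]; trivial
    obtain ⟨M, hM⟩ := isCompact_Icc.exists_bound_of_continuousOn (hC.mono (hc.out ht₁ ht₂))
    refine ⟨max 1 M, le_max_left _ _, fun t ht h => ?_⟩
    rw [← h₂, ← h₁] at h
    have := hM t ⟨(hγ.le_iff_le ht₁ ht).1 h.1, (hγ.le_iff_le ht ht₂).1 h.2⟩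
    exact (le_abs_self _).trans (this.trans (le_max_right _ _))
  choose M hM1 hM using key
  refine ⟨fun t => M ⌊(γ t - σ) / 2⌋, fun t => hM1 _, fun t ht => hM _ t ht ⟨?_, ?_⟩, ?_⟩
  · have := Int.floor_le ((γ t - σ) / 2)
    linarith
  · have := Int.lt_floor_add_one ((γ t - σ) / 2)
    linarith
  · intro l t t' h h'
    have hfl : ∀ u, γ u ∈ Ico (2 * l + σ) (2 * l + σ + 2) → ⌊(γ u - σ) / 2⌋ = l := fun u hu =>
      Int.floor_eq_iff.2 ⟨by linarith [hu.1], by linarith [hu.2]⟩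
    simp only [hfl t h, hfl t' h']

/-- With large enough step functions, `α` and `ε²` are as small as all six maps require. -/
lemma exists_choices {I : Set ℝ} {m : ℕ} {ρ : ℝ → ℝ} {η : Fin m → ℝ → ℝ} {c : ℝ}
    (hI : IsOpen I) (hc : I.OrdConnected) (hne : I.Nonempty) (hρ : ContDiffOn ℝ ∞ ρ I)
    (hρpos : ∀ t ∈ I, 0 < ρ t) (hη : ∀ j, ContDiffOn ℝ ∞ (η j) I) (hc0 : 0 < c) (a : ℕ) :
    ∃ D : Choices I, (∀ t ∈ I, alpha D a η t ≤ 1 / (8 * c)) ∧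
      ∀ t ∈ I, 8 * epsSq D a η t ≤ ρ t ^ 2 := by
  obtain ⟨γ, hγ, hγ', hsurj⟩ := exists_diffeomorphism hI hc hne
  obtain ⟨t₀, ht₀⟩ := hne
  -- The functions `ψ_j` depend on `γ` only, so constant step functions show their smoothness.
  have hψ : ∀ j, ContDiffOn ℝ ∞ (fun t => psiHat j (γ t)) I := fun j =>
    contDiffOn_psi (⟨γ, hγ, hγ', hsurj, t₀, ht₀, fun _ _ => 1, fun _ _ _ => one_pos,
      fun _ _ _ _ _ _ _ _ => rfl⟩ : Choices I) hI j
  have hmono : StrictMonoOn γ I := strictMonoOn_of_deriv_pos hc.convex hγ.continuousOn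
    fun t ht => hγ' t (interior_subset ht)
  set C : Fin 2 → ℝ → ℝ := fun j t => ∑ r : Hi m a,
    (16 / ρ t ^ 2 * deriv (fun s => η r s * psiHat j (γ s)) t ^ 2 +
      16 * c * (η r t * psiHat j (γ t)) ^ 2) with hCdef
  have hC : ∀ j, ContinuousOn (C j) I := by
    intro j
    refine continuousOn_finsetSum _ fun r _ => ?_
    have h1 := (hη r).mul (hψ j)
    have h2 := ((contDiffOn_infty_iff_deriv_of_isOpen hI).1 h1).2
    exact ((continuousOn_const.div (hρ.continuousOn.pow 2) fun t ht =>
      (pow_pos (hρpos t ht) 2).ne').mul (h2.continuousOn.pow 2)).add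
      (continuousOn_const.mul (h1.continuousOn.pow 2))
  choose S hS1 hSC hS using fun j => exists_step_function hc hmono hsurj (hC j) (shift j)
  refine ⟨⟨γ, hγ, hγ', hsurj, t₀, ht₀, S, fun j t _ => one_pos.trans_le (hS1 j t),
    fun j l t _ t' _ h h' => hS j l t t' h h'⟩, fun t ht => ?_, fun t ht => ?_⟩
  · have hj : ∀ j, 16 * c * ∑ r : Hi m a, (η r t * psiHat j (γ t)) ^ 2 / S j t ^ 2 ≤ 1 := by
      intro j
      have hSj := hS1 j t
      rw [← Finset.sum_div, ← mul_div_assoc, div_le_one (by positivity)]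
      calc _ = ∑ r : Hi m a, 16 * c * (η r t * psiHat j (γ t)) ^ 2 := Finset.mul_sum _ _ _
        _ ≤ C j t := Finset.sum_le_sum fun r _ => le_add_of_nonneg_left (by positivity)
        _ ≤ S j t := hSC j t ht
        _ ≤ S j t ^ 2 := by nlinarith
    have h0 := hj 0
    have h1 := hj 1
    rw [le_div_iff₀ (by positivity), alpha, Finset.sum_comm, Fin.sum_univ_two]
    simp only [psi, ← mul_pow]
    linarith
  · have hj : ∀ j, 16 * ∑ r : Hi m a,
        deriv (fun s => η r s * psiHat j (γ s)) t ^ 2 / S j t ^ 2 ≤ ρ t ^ 2 := by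
      intro j
      have hSj := hS1 j t
      have hρt := hρpos t ht
      rw [← Finset.sum_div, ← mul_div_assoc, div_le_iff₀ (by positivity), ← div_le_iff₀'
        (by positivity)]
      calc _ = ∑ r : Hi m a, 16 / ρ t ^ 2 * deriv (fun s => η r s * psiHat j (γ s)) t ^ 2 := by
            rw [← Finset.mul_sum]
            ring
        _ ≤ C j t := Finset.sum_le_sum fun r _ => le_add_of_nonneg_right (by positivity)
        _ ≤ S j t := hSC j t ht
        _ ≤ S j t ^ 2 := by nlinarith
    have h0 := hj 0
    have h1 := hj 1
    rw [epsSq, Finset.sum_comm, Fin.sum_univ_two]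
    simp only [psi]
    linarith

/-! ### From coordinates to isometric immersions and embeddings -/

section reordering

variable {ι : Type}

/-- The signature determines a sign preserving reordering of the coordinates. The number of
negative signs is expressed through the sum of all signs. -/
lemma exists_reordering [Fintype ι] {N a : ℕ} {σ : ι → ℝ} (hσ : ∀ i, σ i = 1 ∨ σ i = -1)
    (hcard : Fintype.card ι = N) (hsum : ∑ i, σ i = N - 2 * a) :
    ∃ e : Fin N ≃ ι, ∀ i, σ (e i) = sgn a i := by
  classical
  have hneg : Fintype.card {i // σ i = -1} = a := by
    have h1 : ((Fintype.card {i // σ i = -1} : ℕ) : ℝ) = ∑ i, (1 - σ i) / 2 := by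
      rw [Fintype.card_subtype, Finset.card_filter]
      push_cast
      refine Finset.sum_congr rfl fun i _ => ?_
      rcases hσ i with h | h <;> rw [h] <;> norm_num
    rw [← Finset.sum_div, Finset.sum_sub_distrib, hsum] at h1
    simp only [Finset.sum_const, Finset.card_univ, hcard, nsmul_eq_mul, mul_one] at h1
    exact_mod_cast (show ((Fintype.card {i // σ i = -1} : ℕ) : ℝ) = a by rw [h1]; ring)
  have haN : a ≤ N := by
    rw [← hneg, ← hcard]
    exact Fintype.card_subtype_le _
  have hlow : Fintype.card {i : Fin N // (i : ℕ) < a} = a := by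
    rw [Fintype.card_subtype]
    rw [Fin.card_filter_val_lt, min_eq_right haN]
  have e₁ : {i : Fin N // (i : ℕ) < a} ≃ {i // σ i = -1} :=
    Fintype.equivOfCardEq (hlow.trans hneg.symm)
  have e₂ : {i : Fin N // ¬ (i : ℕ) < a} ≃ {i // ¬ σ i = -1} :=
    Fintype.equivOfCardEq (by
      rw [Fintype.card_subtype_compl, Fintype.card_subtype_compl, hlow, hneg, hcard,
        Fintype.card_fin])
  refine ⟨(Equiv.sumCompl _).symm.trans ((Equiv.sumCongr e₁ e₂).trans (Equiv.sumCompl _)),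
    fun i => ?_⟩
  by_cases hi : (i : ℕ) < a
  · simp only [Equiv.trans_apply, Equiv.sumCompl_symm_apply_of_pos
      (p := fun i : Fin N => (i : ℕ) < a) hi, Equiv.sumCongr_apply, Sum.map_inl,
      Equiv.sumCompl_apply_inl, sgn, if_pos hi]
    exact (e₁ ⟨i, hi⟩).2
  · simp only [Equiv.trans_apply, Equiv.sumCompl_symm_apply_of_neg
      (p := fun i : Fin N => (i : ℕ) < a) hi, Equiv.sumCongr_apply, Sum.map_inr,
      Equiv.sumCompl_apply_inr, sgn, if_neg hi]
    exact (hσ _).resolve_right (e₂ ⟨i, hi⟩).2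

variable {m N a : ℕ} {I : Set ℝ} {ρ : ℝ → ℝ} {η : Fin m → ℝ → ℝ} {Q : Set (Fin N → ℝ)}
  {σ : ι → ℝ} {F : ℝ × (Fin m → ℝ) → ι → ℝ}

lemma isOpen_domain (hI : IsOpen I) : IsOpen (domain I m) := hI.prod isOpen_univ

/-- A map that is isometric in suitably signed coordinates is an isometric immersion after
reordering. Injectivity of the differential follows since the metric is positive definite. -/
lemma isIsometricImmersion_of_coordinates [Fintype ι] (hI : IsOpen I) (hρpos : ∀ t ∈ I, 0 < ρ t)
    (hηpos : ∀ j, ∀ t ∈ I, 0 < η j t) (e : Fin N ≃ ι) (he : ∀ i, σ (e i) = sgn a i)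
    (hF : ∀ i, ContDiffOn ℝ ∞ (fun p => F p i) (domain I m))
    (hmet : ∀ p ∈ domain I m, ∀ v w, ∑ i, σ i * fderiv ℝ (fun p => F p i) p v *
      fderiv ℝ (fun p => F p i) p w = warpedMetric ρ η p.1 v w)
    (hQ : ∀ p ∈ domain I m, ∀ y : Fin N → ℝ, semiInner a y y = ∑ i, σ i * F p i * F p i → y ∈ Q) :
    IsIsometricImmersion I ρ η a Q (fun p i => F p (e i)) := by
  have hsum : ∀ x y : ι → ℝ, semiInner a (fun i => x (e i)) (fun i => y (e i)) =
      ∑ i, σ i * x i * y i := fun x y => by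
    rw [← e.sum_comp]
    exact Finset.sum_congr rfl fun i _ => by rw [he]
  have hfd : ∀ p ∈ domain I m, ∀ v, fderiv ℝ (fun p i => F p (e i)) p v =
      fun i => fderiv ℝ (fun p => F p (e i)) p v := by
    intro p hp v
    have hd : ∀ i, DifferentiableAt ℝ (fun p => F p (e i)) p := fun i =>
      ((hF (e i)).contDiffAt ((isOpen_domain hI).mem_nhds hp)).differentiableAt (by simp)
    rw [fderiv_pi hd]
    rfl
  have hiso : ∀ p ∈ domain I m, ∀ v w, semiInner a (fderiv ℝ (fun p i => F p (e i)) p v)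
      (fderiv ℝ (fun p i => F p (e i)) p w) = warpedMetric ρ η p.1 v w := by
    intro p hp v w
    rw [hfd p hp, hfd p hp, hsum (fun i => fderiv ℝ (fun p => F p i) p v)
      (fun i => fderiv ℝ (fun p => F p i) p w), hmet p hp]
  refine ⟨contDiffOn_pi.2 fun i => hF (e i), fun p hp => hQ p hp _ (hsum (F p) (F p)), ?_, hiso⟩
  intro p hp
  refine (injective_iff_map_eq_zero _).2 fun v hv => ?_
  have h1 := hiso p hp v v
  have hz : semiInner a (0 : Fin N → ℝ) (0 : Fin N → ℝ) = 0 := by simp [semiInner]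
  rw [hv, hz, warpedMetric] at h1
  have h2 : 0 ≤ ∑ j, η j p.1 ^ 2 * v.2 j * v.2 j := Finset.sum_nonneg fun j _ => by
    rw [mul_assoc]
    exact mul_nonneg (sq_nonneg _) (mul_self_nonneg _)
  have hρp := hρpos p.1 hp.1
  have h3 : 0 ≤ ρ p.1 ^ 2 * v.1 * v.1 := by
    rw [mul_assoc]
    exact mul_nonneg (sq_nonneg _) (mul_self_nonneg _)
  have h4 : ∑ j, η j p.1 ^ 2 * v.2 j * v.2 j = 0 := by linarith
  rw [Finset.sum_eq_zero_iff_of_nonneg fun j _ => by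
    rw [mul_assoc]
    exact mul_nonneg (sq_nonneg _) (mul_self_nonneg _)] at h4
  refine Prod.ext ?_ (funext fun j => ?_)
  · have h5 : ρ p.1 ^ 2 * v.1 * v.1 = 0 := by linarith
    simpa [hρp.ne'] using h5
  · simpa [(hηpos j p.1 hp.1).ne'] using h4 j (Finset.mem_univ j)

/-- An isometric immersion is an embedding if the coordinates of the image control the point.
Injectivity is then automatic, as the domain is a `T0` space. -/
lemma IsIsometricImmersion.isIsometricEmbedding {f : ℝ × (Fin m → ℝ) → Fin N → ℝ}
    (hf : IsIsometricImmersion I ρ η a Q f) (e : Fin N ≃ ι)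
    (hfF : ∀ p i, f p i = F p (e i))
    (hlim : ∀ p : domain I m, ∀ l : Filter (domain I m),
      (∀ i, Tendsto (fun q : domain I m => F q i) l (𝓝 (F p i))) → l ≤ 𝓝 p) :
    IsIsometricEmbedding I ρ η a Q f := by
  refine ⟨hf, Topology.IsInducing.isEmbedding (Topology.isInducing_iff_nhds.2 fun p =>
    le_antisymm ?_ ?_)⟩
  · exact (continuousOn_iff_continuous_domRestrict.1 hf.smooth.continuousOn).continuousAt.le_comap
  · refine hlim p _ fun i => ?_
    have h1 : Tendsto ((domain I m).domRestrict f)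
        (comap ((domain I m).domRestrict f) (𝓝 ((domain I m).domRestrict f p)))
        (𝓝 ((domain I m).domRestrict f p)) := tendsto_comap
    have h2 := tendsto_pi_nhds.1 h1 (e.symm i)
    simpa [hfF] using h2

end reordering

/-! ### Positivity of the radicands -/

/-- The inequality `(x + y)² / (A + L) ≤ x² / A + y² / L` in a form that allows `L = 0`. -/
lemma sq_sub_le_of_sq_le {x y A L q : ℝ} (hA : 0 < A) (hL : 0 ≤ L) (hq : 0 ≤ q)
    (hy : y ^ 2 ≤ 4 * L * q) : (x - y) ^ 2 ≤ 4 * (A + L) * (x ^ 2 / (4 * A) + q) := by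
  have hz : |2 * x * y| ≤ 4 * A * q + L * x ^ 2 / A := by
    refine abs_le_of_sq_le_sq ?_ (by positivity)
    have e : (4 * A * q + L * x ^ 2 / A) ^ 2 - 16 * (L * q) * x ^ 2 / 1 =
        (4 * A * q - L * x ^ 2 / A) ^ 2 := by
      field_simp
      ring
    nlinarith [sq_nonneg (4 * A * q - L * x ^ 2 / A), mul_le_mul_of_nonneg_left hy (sq_nonneg x)]
  have e : 4 * (A + L) * (x ^ 2 / (4 * A) + q) =
      x ^ 2 + 4 * L * q + (4 * A * q + L * x ^ 2 / A) := by
    field_simp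
    ring
  rw [e]
  nlinarith [neg_abs_le (2 * x * y)]

section radicands

variable {I : Set ℝ} {m : ℕ} {D : Choices I} {a : ℕ} {ρ : ℝ → ℝ} {η : Fin m → ℝ → ℝ} {c t : ℝ}

/-- The smallness of the derivative of `α` comes for free from that of `α` and `ε²`. -/
lemma mul_sq_deriv_alpha_le (hI : IsOpen I) (hη : ∀ j, ContDiffOn ℝ ∞ (η j) I) (hc : 0 < c)
    (ht : t ∈ I) (hα : alpha D a η t ≤ 1 / (8 * c)) :
    2 * c * deriv (alpha D a η) t ^ 2 ≤ epsSq D a η t := by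
  have h1 := sq_deriv_alpha_le D a hI hη ht
  rw [le_div_iff₀ (by positivity)] at hα
  have h2 := epsSq_nonneg D a (η := η) t
  have h3 := alpha_nonneg D a (η := η) t
  nlinarith [mul_le_mul_of_nonneg_left h1 hc.le, mul_le_mul_of_nonneg_right hα h2]

lemma loDerivSq_nonneg : 0 ≤ loDerivSq a η t := Finset.sum_nonneg fun _ _ => sq_nonneg _

lemma one_div_sub_beta_ge (hc : 0 < c) (hα : alpha D a η t ≤ 1 / (8 * c)) :
    1 / (2 * c) + loSq a η t ≤ 1 / c - beta D a η t := by
  have e1 : 1 / (8 * c) = 1 / c / 8 := by field_simp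
  have e2 : 1 / (2 * c) = 1 / c / 2 := by field_simp
  have : 0 < 1 / c := by positivity
  rw [beta, e2]
  rw [e1] at hα
  linarith

lemma two_mul_radSq_ge (hc : 0 < c) (hα : alpha D a η t ≤ 1 / (8 * c)) :
    1 / (2 * c) + loSq a η t ≤ 2 * radSq D a c η t := by
  have e1 : 1 / (8 * c) = 1 / c / 8 := by field_simp
  have e2 : 1 / (2 * c) = 1 / c / 2 := by field_simp
  have : 0 < 1 / c := by positivity
  rw [radSq, e2]
  rw [e1] at hα
  linarith

lemma half_one_div_add_loSq_pos (hc : 0 < c) : 0 < 1 / (2 * c) + loSq a η t := by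
  have := loSq_nonneg a (η := η) t
  positivity

lemma radicandS_pos (hI : IsOpen I) (hη : ∀ j, ContDiffOn ℝ ∞ (η j) I) (hc : 0 < c) (ht : t ∈ I)
    (hρ : 0 < ρ t) (hα : alpha D a η t ≤ 1 / (8 * c)) (hε : 8 * epsSq D a η t ≤ ρ t ^ 2) :
    0 < 1 / (1 / c - beta D a η t) * (ρ t ^ 2 + loDerivSq a η t - epsSq D a η t
      - deriv (beta D a η) t ^ 2 / (4 * (1 / c - beta D a η t))) := by
  have hw := one_div_sub_beta_ge (a := a) hc hα
  have hw0 := (half_one_div_add_loSq_pos (a := a) (η := η) (t := t) hc).trans_le hw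
  have hq := loDerivSq_nonneg (a := a) (η := η) (t := t)
  have hβ : deriv (beta D a η) t = deriv (alpha D a η) t - deriv (loSq a η) t :=
    ((hasDerivAt_of_contDiffOn hI (contDiffOn_alpha D a hI hη) ht).sub
      (hasDerivAt_of_contDiffOn hI (contDiffOn_loSq a hη) ht)).deriv
  have h1 := sq_sub_le_of_sq_le (x := deriv (alpha D a η) t) (A := 1 / (2 * c)) (by positivity)
    (loSq_nonneg a t) hq (sq_deriv_loSq_le a hI hη ht)
  have h2 : deriv (beta D a η) t ^ 2 / (4 * (1 / c - beta D a η t)) ≤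
      deriv (alpha D a η) t ^ 2 / (4 * (1 / (2 * c))) + loDerivSq a η t := by
    rw [div_le_iff₀ (by positivity), hβ]
    have : 0 ≤ deriv (alpha D a η) t ^ 2 / (4 * (1 / (2 * c))) + loDerivSq a η t := by positivity
    nlinarith
  have h3 : deriv (alpha D a η) t ^ 2 / (4 * (1 / (2 * c))) =
      (2 * c * deriv (alpha D a η) t ^ 2) / 4 := by field_simp
  have h4 := mul_sq_deriv_alpha_le hI hη hc ht hα
  have h5 := pow_pos hρ 2
  refine mul_pos (by positivity) ?_
  linarith

lemma radicandHatS_pos (hI : IsOpen I) (hη : ∀ j, ContDiffOn ℝ ∞ (η j) I) (hc : 0 < c)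
    (ht : t ∈ I) (hρ : 0 < ρ t) (hα : alpha D a η t ≤ 1 / (8 * c))
    (hε : 8 * epsSq D a η t ≤ ρ t ^ 2) :
    0 < (ρ t ^ 2 + loDerivSq a η t - 2 * epsSq D a η t
      - 2 * (deriv (fun s => -alpha D a η s + loSq a η s / 2) t ^ 2 / (4 * radSq D a c η t)))
      / radSq D a c η t := by
  have hw := two_mul_radSq_ge (a := a) hc hα
  have hw0 := (half_one_div_add_loSq_pos (a := a) (η := η) (t := t) hc).trans_le hw
  have hw1 : 0 < radSq D a c η t := by linarith
  have hq := loDerivSq_nonneg (a := a) (η := η) (t := t)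
  have hβ : deriv (fun s => -alpha D a η s + loSq a η s / 2) t =
      -deriv (alpha D a η) t + deriv (loSq a η) t / 2 :=
    ((hasDerivAt_of_contDiffOn hI (contDiffOn_alpha D a hI hη) ht).neg.add
      ((hasDerivAt_of_contDiffOn hI (contDiffOn_loSq a hη) ht).div_const 2)).deriv
  have h1 := sq_sub_le_of_sq_le (x := 2 * deriv (alpha D a η) t) (A := 1 / (2 * c)) (by positivity)
    (loSq_nonneg a t) hq (sq_deriv_loSq_le a hI hη ht)
  have h2 : 2 * (deriv (fun s => -alpha D a η s + loSq a η s / 2) t ^ 2 /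
      (4 * radSq D a c η t)) ≤
      (2 * deriv (alpha D a η) t) ^ 2 / (4 * (1 / (2 * c))) + loDerivSq a η t := by
    rw [← mul_div_assoc, div_le_iff₀ (by positivity), hβ]
    have : 0 ≤ (2 * deriv (alpha D a η) t) ^ 2 / (4 * (1 / (2 * c))) + loDerivSq a η t := by
      positivity
    nlinarith
  have h3 : (2 * deriv (alpha D a η) t) ^ 2 / (4 * (1 / (2 * c))) =
      2 * c * deriv (alpha D a η) t ^ 2 := by
    field_simp
    ring
  have h4 := mul_sq_deriv_alpha_le hI hη hc ht hα
  have h5 := pow_pos hρ 2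
  refine div_pos ?_ hw1
  linarith

end radicands

/-! ### The metric of plane curves in polar coordinates -/

/-- The derivative of the curve `g`. -/
def dg (u : ℝ) : Fin 2 → ℝ := ![-Real.sin u, Real.cos u]

/-- The derivative of the curve `h`. -/
def dh (u : ℝ) : Fin 2 → ℝ := ![Real.sinh u, Real.cosh u]

lemma contDiff_g (i : Fin 2) : ContDiff ℝ ∞ fun u => g u i := by
  fin_cases i
  · exact Real.contDiff_cos
  · exact Real.contDiff_sin

lemma contDiff_h (i : Fin 2) : ContDiff ℝ ∞ fun u => h u i := by
  fin_cases i
  · exact Real.contDiff_cosh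
  · exact Real.contDiff_sinh

lemma hasDerivAt_g (i : Fin 2) (u : ℝ) : HasDerivAt (fun u => g u i) (dg u i) u := by
  fin_cases i
  · exact Real.hasDerivAt_cos u
  · exact Real.hasDerivAt_sin u

lemma hasDerivAt_h (i : Fin 2) (u : ℝ) : HasDerivAt (fun u => h u i) (dh u i) u := by
  fin_cases i
  · exact Real.hasDerivAt_cosh u
  · exact Real.hasDerivAt_sinh u

lemma polar_g (x y x' y' u : ℝ) :
    ∑ i, (x * g u i + y * dg u i) * (x' * g u i + y' * dg u i) = x * x' + y * y' := by
  simp only [g, dg, Fin.sum_univ_two, Matrix.cons_val_zero, Matrix.cons_val_one]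
  linear_combination (x * x' + y * y') * Real.sin_sq_add_cos_sq u

lemma polar_h (x y x' y' u : ℝ) :
    ∑ i, sgn₂ i * (x * h u i + y * dh u i) * (x' * h u i + y' * dh u i) = -x * x' + y * y' := by
  simp only [h, dh, sgn₂, Fin.sum_univ_two, Matrix.cons_val_zero, Matrix.cons_val_one]
  linear_combination (-x * x' + y * y') * Real.cosh_sq_sub_sinh_sq u

lemma sum_sq_g (R u : ℝ) : ∑ i, (R * g u i) * (R * g u i) = R ^ 2 := by
  have := polar_g R 0 R 0 u
  simp only [zero_mul, add_zero] at this
  rw [this, sq]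

lemma sum_sgn_sq_h (R u : ℝ) : ∑ i, sgn₂ i * (R * h u i) * (R * h u i) = -R ^ 2 := by
  have := polar_h R 0 R 0 u
  simp only [zero_mul, add_zero] at this
  rw [this]
  ring

section curves

variable {R θ : ℝ → ℝ} {R' θ' t : ℝ}

lemma hasDerivAt_mul_comp {G : ℝ → ℝ} {G' : ℝ} (hR : HasDerivAt R R' t) (hθ : HasDerivAt θ θ' t)
    (hG : HasDerivAt G G' (θ t)) :
    HasDerivAt (fun s => R s * G (θ s)) (R' * G (θ t) + R t * θ' * G') t :=
  (hR.mul (hG.comp t hθ)).congr_deriv (by simp only [Function.comp]; ring)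

lemma sum_sq_deriv_g (hR : HasDerivAt R R' t) (hθ : HasDerivAt θ θ' t) :
    ∑ i, deriv (fun s => R s * g (θ s) i) t ^ 2 = R' ^ 2 + R t ^ 2 * θ' ^ 2 := by
  have := polar_g R' (R t * θ') R' (R t * θ') (θ t)
  rw [← mul_pow, sq, sq, ← this]
  exact Finset.sum_congr rfl fun i _ => by
    rw [(hasDerivAt_mul_comp hR hθ (hasDerivAt_g i _)).deriv, sq]

lemma sum_sgn_sq_deriv_h (hR : HasDerivAt R R' t) (hθ : HasDerivAt θ θ' t) :
    ∑ i, sgn₂ i * deriv (fun s => R s * h (θ s) i) t ^ 2 = -R' ^ 2 + R t ^ 2 * θ' ^ 2 := by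
  have := polar_h R' (R t * θ') R' (R t * θ') (θ t)
  rw [← mul_pow, sq, sq, ← neg_mul, ← this]
  exact Finset.sum_congr rfl fun i _ => by
    rw [(hasDerivAt_mul_comp hR hθ (hasDerivAt_h i _)).deriv, sq, ← mul_assoc]

/-- The angles `T_1` and `T_2` together have unit speed, so a pair of circles with these angles
behaves as a single circle, but with twice the radial part. -/
lemma sum_sq_deriv_g_T (hR : HasDerivAt R R' t) (hθ : HasDerivAt θ θ' t) :
    ∑ q : Fin 2 × Fin 2, deriv (fun s => R s * g (T q.1 (θ s)) q.2) t ^ 2 =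
      2 * R' ^ 2 + R t ^ 2 * θ' ^ 2 := by
  have h1 := fun i => sum_sq_deriv_g hR ((hasDerivAt_T i (θ t)).comp t hθ)
  simp only [Function.comp] at h1
  simp only [Fintype.sum_prod_type, h1]
  rw [Fin.sum_univ_two]
  linear_combination R t ^ 2 * θ' ^ 2 * deriv_T_sq_add_deriv_T_sq (θ t)

lemma sum_sq_g_T (R u : ℝ) :
    ∑ q : Fin 2 × Fin 2, (R * g (T q.1 u) q.2) * (R * g (T q.1 u) q.2) = 2 * R ^ 2 := by
  simp only [Fintype.sum_prod_type, sum_sq_g]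
  rw [Fin.sum_univ_two]
  ring

lemma hasDerivAt_sqrt_sq {w : ℝ → ℝ} {w' : ℝ} (hw : HasDerivAt w w' t) (hpos : 0 < w t) :
    ∃ R', HasDerivAt (fun s => Real.sqrt (w s)) R' t ∧ R' ^ 2 = w' ^ 2 / (4 * w t) := by
  refine ⟨_, hw.sqrt hpos.ne', ?_⟩
  rw [div_pow, mul_pow, Real.sq_sqrt hpos.le]
  norm_num

end curves

/-! ### The blocks depending on the fibre coordinates -/

section blocks

variable {I : Set ℝ} {m : ℕ} {a : ℕ} {η : Fin m → ℝ → ℝ}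

lemma contDiffOn_hBlock (hη : ∀ j, ContDiffOn ℝ ∞ (η j) I) (q : Lo m a × Fin 2) :
    ContDiffOn ℝ ∞ (fun p : ℝ × (Fin m → ℝ) => hBlock a η p.1 p.2 q) (domain I m) := by
  have h1 : ContDiffOn ℝ ∞ (fun p : ℝ × (Fin m → ℝ) => η q.1 p.1) (domain I m) :=
    (hη q.1).comp contDiffOn_fst fun p hp => hp.1
  have h2 : ContDiff ℝ ∞ fun p : ℝ × (Fin m → ℝ) => p.2 q.1 := by fun_prop
  exact h1.mul ((contDiff_h q.2).comp h2).contDiffOn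

/-- Each hyperbolic block contributes `-η_k'² dt² + η_k² dx_k²`. -/
lemma metric_hBlock (hI : IsOpen I) (hη : ∀ j, ContDiffOn ℝ ∞ (η j) I) {p : ℝ × (Fin m → ℝ)}
    (hp : p ∈ domain I m) (v w : ℝ × (Fin m → ℝ)) :
    ∑ q : Lo m a × Fin 2, sgn₂ q.2 * fderiv ℝ (fun p => hBlock a η p.1 p.2 q) p v *
      fderiv ℝ (fun p => hBlock a η p.1 p.2 q) p w =
      -loDerivSq a η p.1 * v.1 * w.1 + ∑ k : Lo m a, η k p.1 ^ 2 * v.2 k * w.2 k := by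
  rw [Fintype.sum_prod_type, loDerivSq, ← Finset.sum_neg_distrib, Finset.sum_mul, Finset.sum_mul,
    ← Finset.sum_add_distrib]
  refine Finset.sum_congr rfl fun k _ => ?_
  have hd : ∀ i v, fderiv ℝ (fun p : ℝ × (Fin m → ℝ) => hBlock a η p.1 p.2 (k, i)) p v =
      deriv (η k) p.1 * v.1 * h (p.2 k) i + η k p.1 * v.2 k * dh (p.2 k) i := by
    intro i v
    have := hasFDerivAt_fst_mul_comp (hasDerivAt_of_contDiffOn hI (hη k) hp.1)
      (hasFDerivAt_snd_apply (k : Fin m) p) (hasDerivAt_h i (p.2 k))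
    change fderiv ℝ (fun p : ℝ × (Fin m → ℝ) => η k p.1 * h (p.2 k) i) p v = _
    rw [this.fderiv]
    simp only [add_apply, smul_apply, ContinuousLinearMap.coe_fst',
      ContinuousLinearMap.comp_apply, ContinuousLinearMap.coe_snd',
      ContinuousLinearMap.proj_apply, smul_eq_mul]
    ring
  simp only [hd, polar_h]
  ring

lemma sum_sgn_sq_hBlock (t : ℝ) (x : Fin m → ℝ) :
    ∑ q : Lo m a × Fin 2, sgn₂ q.2 * hBlock a η t x q * hBlock a η t x q = -loSq a η t := by
  rw [Fintype.sum_prod_type, loSq, ← Finset.sum_neg_distrib]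
  exact Finset.sum_congr rfl fun k _ => sum_sgn_sq_h _ _

/-- A Euclidean block that depends on the last `m - a` fibre coordinates, contributes
`κ dt² + ∑ η_r² dx_r²` to the metric and has squared norm `ν`. -/
structure IsEuclideanBlock (I : Set ℝ) (a : ℕ) (η : Fin m → ℝ → ℝ) {β : Type} [Fintype β]
    (B : ℝ → (Fin m → ℝ) → β → ℝ) (κ ν : ℝ → ℝ) : Prop where
  smooth : ∀ i, ContDiffOn ℝ ∞ (fun p : ℝ × (Fin m → ℝ) => B p.1 p.2 i) (domain I m)
  metric : ∀ p ∈ domain I m, ∀ v w : ℝ × (Fin m → ℝ),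
    ∑ i, fderiv ℝ (fun p : ℝ × (Fin m → ℝ) => B p.1 p.2 i) p v *
      fderiv ℝ (fun p : ℝ × (Fin m → ℝ) => B p.1 p.2 i) p w =
      κ p.1 * v.1 * w.1 + ∑ r : Hi m a, η r p.1 ^ 2 * v.2 r * w.2 r
  sum_sq : ∀ p ∈ domain I m, ∑ i, B p.1 p.2 i * B p.1 p.2 i = ν p.1

variable (D : Choices I)

lemma psi_sq_add_psi_sq (t : ℝ) : psi D 0 t ^ 2 + psi D 1 t ^ 2 = 1 :=
  psiHat_sq_add_psiHat_sq _

lemma isEuclideanBlock_phiBlock (hI : IsOpen I) (hη : ∀ j, ContDiffOn ℝ ∞ (η j) I) :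
    IsEuclideanBlock I a η (phiBlock D a η) (epsSq D a η) (alpha D a η) := by
  refine ⟨?_, ?_, ?_⟩
  · rintro ⟨r, j, i⟩
    have h1 := contDiffOn_rotating D hI j (hη r) (contDiff_g i) (r : Fin m)
    exact h1.congr fun p _ => by simp only [phiBlock, phi, Pi.smul_apply, smul_eq_mul]
  · intro p hp v w
    rw [Fintype.sum_prod_type, epsSq, Finset.sum_mul, Finset.sum_mul, ← Finset.sum_add_distrib]
    refine Finset.sum_congr rfl fun r _ => ?_
    have hd : ∀ j i v, fderiv ℝ (fun p : ℝ × (Fin m → ℝ) => phiBlock D a η p.1 p.2 (r, j, i)) p v =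
        deriv (fun t => η r t * psi D j t) p.1 / D.S j p.1 * v.1 * g (D.S j p.1 * p.2 r) i +
          η r p.1 * psi D j p.1 * v.2 r * dg (D.S j p.1 * p.2 r) i := by
      intro j i v
      refine (fderiv_rotating D hI j (hη r)
        ((contDiff_g i).differentiable (by simp)) (r : Fin m) hp.1 v).trans ?_
      rw [(hasDerivAt_g i _).deriv]
      ring
    simp only [Fintype.sum_prod_type, hd, polar_g]
    simp only [Fin.sum_univ_two]
    linear_combination η r p.1 ^ 2 * v.2 r * w.2 r * psi_sq_add_psi_sq D p.1
  · intro p hp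
    rw [Fintype.sum_prod_type, alpha]
    refine Finset.sum_congr rfl fun r _ => ?_
    rw [Fintype.sum_prod_type]
    refine Finset.sum_congr rfl fun j _ => ?_
    have e : ∀ i, phiBlock D a η p.1 p.2 (r, j, i) =
        η r p.1 * (psi D j p.1 / D.S j p.1) * g (D.S j p.1 * p.2 r) i := fun i => by
      simp only [phiBlock, phi, Pi.smul_apply, smul_eq_mul]
      ring
    simp only [e, sum_sq_g]
    ring

lemma contDiff_g_T (i k : Fin 2) : ContDiff ℝ ∞ fun u => g (T i u) k :=
  (contDiff_g k).comp (contDiff_T i)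

/-- Doubling the circles by means of `T_1` and `T_2` doubles the part in `dt²` only. -/
lemma isEuclideanBlock_phiHatBlock (hI : IsOpen I) (hη : ∀ j, ContDiffOn ℝ ∞ (η j) I) :
    IsEuclideanBlock I a η (phiHatBlock D a η) (fun t => 2 * epsSq D a η t)
      (fun t => 2 * alpha D a η t) := by
  refine ⟨?_, ?_, ?_⟩
  · rintro ⟨r, ⟨j, i⟩, k⟩
    have h1 := contDiffOn_rotating D hI j (hη r) (contDiff_g_T i k) (r : Fin m)
    exact h1.congr fun p _ => by simp only [phiHatBlock, phiHat, Pi.smul_apply, smul_eq_mul]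
  · intro p hp v w
    rw [Fintype.sum_prod_type, epsSq, Finset.mul_sum, Finset.sum_mul, Finset.sum_mul,
      ← Finset.sum_add_distrib]
    refine Finset.sum_congr rfl fun r _ => ?_
    have hd : ∀ j i k v,
        fderiv ℝ (fun p : ℝ × (Fin m → ℝ) => phiHatBlock D a η p.1 p.2 (r, (j, i), k)) p v =
        deriv (fun t => η r t * psi D j t) p.1 / D.S j p.1 * v.1 *
          g (T i (D.S j p.1 * p.2 r)) k +
          η r p.1 * psi D j p.1 * v.2 r * deriv (T i) (D.S j p.1 * p.2 r) *
            dg (T i (D.S j p.1 * p.2 r)) k := by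
      intro j i k v
      refine (fderiv_rotating D hI j (hη r)
        ((contDiff_g_T i k).differentiable (by simp)) (r : Fin m) hp.1 v).trans ?_
      have h1 : HasDerivAt (fun u => g (T i u) k) _ (D.S j p.1 * p.2 r) :=
        (hasDerivAt_g k _).comp _ (hasDerivAt_T i _)
      rw [h1.deriv]
      ring
    simp only [Fintype.sum_prod_type, hd, polar_g]
    simp only [Fin.sum_univ_two]
    linear_combination η r p.1 ^ 2 * v.2 r * w.2 r * (psi_sq_add_psi_sq D p.1 +
      psi D 0 p.1 ^ 2 * deriv_T_sq_add_deriv_T_sq (D.S 0 p.1 * p.2 r) +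
      psi D 1 p.1 ^ 2 * deriv_T_sq_add_deriv_T_sq (D.S 1 p.1 * p.2 r))
  · intro p hp
    rw [Fintype.sum_prod_type, alpha, Finset.mul_sum]
    refine Finset.sum_congr rfl fun r _ => ?_
    have e : ∀ j i k, phiHatBlock D a η p.1 p.2 (r, (j, i), k) =
        η r p.1 * (psi D j p.1 / D.S j p.1) * g (T i (D.S j p.1 * p.2 r)) k := fun j i k => by
      simp only [phiHatBlock, phiHat, Pi.smul_apply, smul_eq_mul]
      ring
    simp only [Fintype.sum_prod_type, e, sum_sq_g]
    simp only [Fin.sum_univ_two]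
    ring

end blocks

/-! ### Assembling the blocks -/

section assembling

variable {I : Set ℝ} {m : ℕ} {a : ℕ} {ρ : ℝ → ℝ} {η : Fin m → ℝ → ℝ} {A β : Type}
  {N : ℕ} {B : ℝ → (Fin m → ℝ) → β → ℝ} {κ ν : ℝ → ℝ}

lemma sum_lo_add_sum_hi (f : Fin m → ℝ) : ∑ k : Lo m a, f k + ∑ r : Hi m a, f r = ∑ j, f j := by
  have e : ∑ r : Hi m a, f r = ∑ r : {j : Fin m // ¬ (j : ℕ) < a}, f r :=
    Fintype.sum_equiv (Equiv.subtypeEquivRight fun _ => not_lt.symm) _ _ fun _ => rfl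
  rw [e, Fintype.sum_subtype_add_sum_subtype (fun j : Fin m => (j : ℕ) < a) f]

lemma card_lo (ha : a ≤ m) : Fintype.card (Lo m a) = a := by
  rw [Fintype.card_subtype, Fin.card_filter_val_lt, min_eq_right ha]

lemma card_hi (ha : a ≤ m) : Fintype.card (Hi m a) = m - a := by
  have := Fintype.card_congr (Equiv.subtypeEquivRight (p := fun r : Fin m => a ≤ (r : ℕ))
    (q := fun r : Fin m => ¬ (r : ℕ) < a) fun j => not_lt.symm)
  rw [this, Fintype.card_subtype_compl, card_lo ha, Fintype.card_fin]

/-- A map into `A × (ℝ²_1)^a × B` whose first component `u` depends on `t` only. -/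
def sphericalMap (a : ℕ) (η : Fin m → ℝ → ℝ) (u : ℝ → A → ℝ) (B : ℝ → (Fin m → ℝ) → β → ℝ)
    (p : ℝ × (Fin m → ℝ)) : A ⊕ (Lo m a × Fin 2) ⊕ β → ℝ :=
  Sum.elim (u p.1) (Sum.elim (hBlock a η p.1 p.2) (B p.1 p.2))

/-- A map into `ℝ²_1 × ℝ^a × (ℝ²_1)^a × B` whose first component `u` depends on `t` only and
whose second component cancels the negative part `-∑ η_k'² dt²` of the third. -/
def hyperbolicMap (a : ℕ) (η : Fin m → ℝ → ℝ) (u : ℝ → Fin 2 → ℝ) (B : ℝ → (Fin m → ℝ) → β → ℝ)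
    (p : ℝ × (Fin m → ℝ)) : Fin 2 ⊕ Lo m a ⊕ (Lo m a × Fin 2) ⊕ β → ℝ :=
  Sum.elim (u p.1) (Sum.elim (loBlock a η p.1) (Sum.elim (hBlock a η p.1 p.2) (B p.1 p.2)))

lemma fderiv_comp_fst (hI : IsOpen I) {u : ℝ → ℝ} (hu : ContDiffOn ℝ ∞ u I)
    {p : ℝ × (Fin m → ℝ)} (hp : p ∈ domain I m) (v : ℝ × (Fin m → ℝ)) :
    fderiv ℝ (fun p : ℝ × (Fin m → ℝ) => u p.1) p v = deriv u p.1 * v.1 := by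
  have h1 : HasFDerivAt (fun p : ℝ × (Fin m → ℝ) => u p.1)
      (deriv u p.1 • ContinuousLinearMap.fst ℝ ℝ (Fin m → ℝ)) p :=
    (hasDerivAt_of_contDiffOn hI hu hp.1).comp_hasFDerivAt p hasFDerivAt_fst
  rw [h1.fderiv]
  rfl

lemma contDiffOn_comp_fst {u : ℝ → ℝ} (hu : ContDiffOn ℝ ∞ u I) :
    ContDiffOn ℝ ∞ (fun p : ℝ × (Fin m → ℝ) => u p.1) (domain I m) :=
  hu.comp contDiffOn_fst fun _ hp => hp.1

lemma sphericalMap_isIsometricImmersion [Fintype A] [Fintype β] (hI : IsOpen I)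
    (hρpos : ∀ t ∈ I, 0 < ρ t) (hη : ∀ j, ContDiffOn ℝ ∞ (η j) I)
    (hηpos : ∀ j, ∀ t ∈ I, 0 < η j t) {u : ℝ → A → ℝ}
    (hB : IsEuclideanBlock I a η B κ ν) (hu : ∀ i, ContDiffOn ℝ ∞ (fun t => u t i) I)
    (hmet : ∀ t ∈ I, ∑ i, deriv (fun s => u s i) t ^ 2 = ρ t ^ 2 + loDerivSq a η t - κ t)
    {Q : Set (Fin N → ℝ)} (hQ : ∀ t ∈ I, ∀ y : Fin N → ℝ,
      semiInner a y y = ∑ i, u t i * u t i - loSq a η t + ν t → y ∈ Q)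
    (e : Fin N ≃ A ⊕ (Lo m a × Fin 2) ⊕ β) (he : ∀ i, sgnRS A m a β (e i) = sgn a i) :
    IsIsometricImmersion I ρ η a Q (fun p i => sphericalMap a η u B p (e i)) := by
  refine isIsometricImmersion_of_coordinates hI hρpos hηpos e he ?_ ?_ ?_
  · rintro (i | q | i)
    · exact contDiffOn_comp_fst (hu i)
    · exact contDiffOn_hBlock hη q
    · exact hB.smooth i
  · intro p hp v w
    simp only [Fintype.sum_sum_type, sgnRS, sphericalMap, Sum.elim_inl, Sum.elim_inr, one_mul]
    rw [metric_hBlock hI hη hp, hB.metric p hp, warpedMetric,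
      ← sum_lo_add_sum_hi (a := a) fun j => η j p.1 ^ 2 * v.2 j * w.2 j]
    have h1 : ∑ i, fderiv ℝ (fun p : ℝ × (Fin m → ℝ) => u p.1 i) p v *
        fderiv ℝ (fun p : ℝ × (Fin m → ℝ) => u p.1 i) p w =
        (ρ p.1 ^ 2 + loDerivSq a η p.1 - κ p.1) * v.1 * w.1 := by
      rw [← hmet p.1 hp.1, Finset.sum_mul, Finset.sum_mul]
      refine Finset.sum_congr rfl fun i _ => ?_
      rw [fderiv_comp_fst hI (hu i) hp, fderiv_comp_fst hI (hu i) hp]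
      ring
    rw [h1]
    ring
  · intro p hp y hy
    refine hQ p.1 hp.1 y ?_
    rw [hy]
    simp only [Fintype.sum_sum_type, sgnRS, sphericalMap, Sum.elim_inl, Sum.elim_inr, one_mul]
    rw [sum_sgn_sq_hBlock, hB.sum_sq p hp]
    ring

lemma hyperbolicMap_isIsometricImmersion [Fintype β] (hI : IsOpen I)
    (hρpos : ∀ t ∈ I, 0 < ρ t) (hη : ∀ j, ContDiffOn ℝ ∞ (η j) I)
    (hηpos : ∀ j, ∀ t ∈ I, 0 < η j t) {u : ℝ → Fin 2 → ℝ}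
    (hB : IsEuclideanBlock I a η B κ ν) (hu : ∀ i, ContDiffOn ℝ ∞ (fun t => u t i) I)
    (hmet : ∀ t ∈ I, ∑ i, sgn₂ i * deriv (fun s => u s i) t ^ 2 = ρ t ^ 2 - κ t)
    {Q : Set (Fin N → ℝ)} (hQ : ∀ t ∈ I, ∀ y : Fin N → ℝ,
      semiInner (a + 1) y y = ∑ i, sgn₂ i * u t i * u t i + ν t → y ∈ Q)
    (e : Fin N ≃ Fin 2 ⊕ Lo m a ⊕ (Lo m a × Fin 2) ⊕ β)
    (he : ∀ i, sgnH m a β (e i) = sgn (a + 1) i) :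
    IsIsometricImmersion I ρ η (a + 1) Q (fun p i => hyperbolicMap a η u B p (e i)) := by
  refine isIsometricImmersion_of_coordinates hI hρpos hηpos e he ?_ ?_ ?_
  · rintro (i | k | q | i)
    · exact contDiffOn_comp_fst (hu i)
    · exact contDiffOn_comp_fst (hη k)
    · exact contDiffOn_hBlock hη q
    · exact hB.smooth i
  · intro p hp v w
    simp only [Fintype.sum_sum_type, sgnH, hyperbolicMap, Sum.elim_inl, Sum.elim_inr, one_mul]
    rw [metric_hBlock hI hη hp, hB.metric p hp, warpedMetric,
      ← sum_lo_add_sum_hi (a := a) fun j => η j p.1 ^ 2 * v.2 j * w.2 j]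
    have h1 : ∑ i, sgn₂ i * fderiv ℝ (fun p : ℝ × (Fin m → ℝ) => u p.1 i) p v *
        fderiv ℝ (fun p : ℝ × (Fin m → ℝ) => u p.1 i) p w =
        (ρ p.1 ^ 2 - κ p.1) * v.1 * w.1 := by
      rw [← hmet p.1 hp.1, Finset.sum_mul, Finset.sum_mul]
      refine Finset.sum_congr rfl fun i _ => ?_
      rw [fderiv_comp_fst hI (hu i) hp, fderiv_comp_fst hI (hu i) hp]
      ring
    have h2 : ∑ k, fderiv ℝ (fun p : ℝ × (Fin m → ℝ) => loBlock a η p.1 k) p v *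
        fderiv ℝ (fun p : ℝ × (Fin m → ℝ) => loBlock a η p.1 k) p w =
        loDerivSq a η p.1 * v.1 * w.1 := by
      rw [loDerivSq, Finset.sum_mul, Finset.sum_mul]
      refine Finset.sum_congr rfl fun k _ => ?_
      unfold loBlock
      rw [fderiv_comp_fst hI (hη k) hp, fderiv_comp_fst hI (hη k) hp]
      ring
    rw [h1, h2]
    ring
  · intro p hp y hy
    refine hQ p.1 hp.1 y ?_
    rw [hy]
    simp only [Fintype.sum_sum_type, sgnH, hyperbolicMap, Sum.elim_inl, Sum.elim_inr, one_mul]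
    rw [sum_sgn_sq_hBlock, hB.sum_sq p hp]
    simp only [loBlock, loSq, sq]
    ring

lemma exists_reordering_sgnRS [Fintype A] [Fintype β] (ha : a ≤ m)
    (hN : Fintype.card A + (a * 2 + Fintype.card β) = N) :
    ∃ e : Fin N ≃ A ⊕ (Lo m a × Fin 2) ⊕ β, ∀ i, sgnRS A m a β (e i) = sgn a i := by
  refine exists_reordering ?_ ?_ ?_
  · rintro (i | ⟨k, i⟩ | i)
    · exact Or.inl rfl
    · fin_cases i
      · exact Or.inr rfl
      · exact Or.inl rfl
    · exact Or.inl rfl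
  · simp [card_lo ha, hN]
  · rw [← hN]
    simp only [Fintype.sum_sum_type, sgnRS, Sum.elim_inl, Sum.elim_inr, Fintype.sum_prod_type,
      sgn₂, Fin.sum_univ_two, Matrix.cons_val_zero, Matrix.cons_val_one, Finset.sum_const,
      Finset.card_univ, nsmul_eq_mul]
    push_cast
    ring

lemma exists_reordering_sgnH [Fintype β] (ha : a ≤ m)
    (hN : 2 + (a + (a * 2 + Fintype.card β)) = N) :
    ∃ e : Fin N ≃ Fin 2 ⊕ Lo m a ⊕ (Lo m a × Fin 2) ⊕ β,
      ∀ i, sgnH m a β (e i) = sgn (a + 1) i := by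
  refine exists_reordering ?_ ?_ ?_
  · have h2 : ∀ i : Fin 2, sgn₂ i = 1 ∨ sgn₂ i = -1 := fun i => by fin_cases i <;> simp [sgn₂]
    rintro (i | k | ⟨k, i⟩ | i)
    · exact h2 i
    · exact Or.inl rfl
    · exact h2 i
    · exact Or.inl rfl
  · simp [card_lo ha, hN]
  · rw [← hN]
    simp only [Fintype.sum_sum_type, sgnH, Sum.elim_inl, Sum.elim_inr, Fintype.sum_prod_type,
      sgn₂, Fin.sum_univ_two, Matrix.cons_val_zero, Matrix.cons_val_one, Finset.sum_const,
      Finset.card_univ, nsmul_eq_mul, card_lo ha]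
    push_cast
    ring

end assembling

/-! ### Recovering a point from its image -/

section limits

variable {X : Type*} {l : Filter X}

lemma tendsto_of_tendsto_strictMonoOn {I : Set ℝ} (hI : IsOpen I) {θ : ℝ → ℝ}
    (hθ : StrictMonoOn θ I) {τ : X → ℝ} (hτ : ∀ x, τ x ∈ I) {t : ℝ} (ht : t ∈ I)
    (hlim : Tendsto (fun x => θ (τ x)) l (𝓝 (θ t))) : Tendsto τ l (𝓝 t) := by
  obtain ⟨x, y, hxy, hsub⟩ := mem_nhds_iff_exists_Ioo_subset.1 (hI.mem_nhds ht)
  refine tendsto_order.2 ⟨fun b hb => ?_, fun b hb => ?_⟩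
  · obtain ⟨s, hs, hst⟩ := exists_between (max_lt hb hxy.1)
    have hsI : s ∈ I := hsub ⟨(le_max_right _ _).trans_lt hs, hst.trans hxy.2⟩
    filter_upwards [(tendsto_order.1 hlim).1 _ (hθ hsI ht hst)] with q hq
    exact ((le_max_left _ _).trans_lt hs).trans ((hθ.lt_iff_lt hsI (hτ q)).1 hq)
  · obtain ⟨s, hts, hs⟩ := exists_between (lt_min hb hxy.2)
    have hsI : s ∈ I := hsub ⟨hxy.1.trans hts, hs.trans_le (min_le_right _ _)⟩
    filter_upwards [(tendsto_order.1 hlim).2 _ (hθ ht hsI hts)] with q hq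
    exact ((hθ.lt_iff_lt (hτ q) hsI).1 hq).trans (hs.trans_le (min_le_left _ _))

lemma tendsto_of_tendsto_T₁ {y : X → ℝ} {y₀ : ℝ}
    (hlim : Tendsto (fun x => T₁ (y x)) l (𝓝 (T₁ y₀))) : Tendsto y l (𝓝 y₀) :=
  tendsto_of_tendsto_strictMonoOn isOpen_univ (strictMono_T₁.strictMonoOn univ)
    (fun _ => mem_univ _) (mem_univ _) hlim

/-- The point `R g(T_1(y))` controls `y`, without control of the radius `R`. -/
lemma tendsto_of_tendsto_mul_g_T₁ {R y : X → ℝ} {R₀ y₀ : ℝ} (hR₀ : R₀ ≠ 0)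
    (hR : ∀ᶠ x in l, R x ≠ 0)
    (hlim : ∀ i, Tendsto (fun x => R x * g (T₁ (y x)) i) l (𝓝 (R₀ * g (T₁ y₀) i))) :
    Tendsto y l (𝓝 y₀) := by
  have h1 := (hlim 1).div (hlim 0) (mul_ne_zero hR₀ (cos_T₁_pos y₀).ne')
  rw [mul_div_mul_left _ _ hR₀] at h1
  have h2 := (Real.continuous_arctan.tendsto _).comp h1
  have e : ∀ u, Real.arctan (g (T₁ u) 1 / g (T₁ u) 0) = T₁ u := arctan_T₁
  rw [e] at h2
  refine tendsto_of_tendsto_T₁ (h2.congr' ?_)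
  filter_upwards [hR] with x hx
  simp only [Function.comp, Pi.div_apply]
  rw [mul_div_mul_left _ _ hx, e]

/-- The point `R h(y)` controls `y`, without control of the radius `R`. -/
lemma tendsto_of_tendsto_mul_h {R y : X → ℝ} {R₀ y₀ : ℝ} (hR₀ : R₀ ≠ 0) (hR : ∀ x, R x ≠ 0)
    (hlim : ∀ i, Tendsto (fun x => R x * h (y x) i) l (𝓝 (R₀ * h y₀ i))) :
    Tendsto y l (𝓝 y₀) := by
  have h1 := (hlim 1).div (hlim 0) (mul_ne_zero hR₀ (Real.cosh_pos y₀).ne')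
  rw [mul_div_mul_left _ _ hR₀] at h1
  have e : ∀ u, Real.pi / 4 * (1 + h u 1 / h u 0) = T₁ u := fun u => by
    rw [T₁, Real.tanh_eq_sinh_div_cosh]
    rfl
  have h2 := (h1.const_add 1).const_mul (Real.pi / 4)
  rw [e] at h2
  refine tendsto_of_tendsto_T₁ (h2.congr fun x => ?_)
  simp only [Pi.div_apply]
  rw [mul_div_mul_left _ _ (hR x), e]

variable {I : Set ℝ} {m : ℕ} (D : Choices I) {a : ℕ} {η : Fin m → ℝ → ℝ}

/-- Once `t` is under control, the blocks of an embedding control the fibre coordinates. -/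
lemma le_nhds_of_tendsto_blocks (hI : IsOpen I) (hη : ∀ j, ContDiffOn ℝ ∞ (η j) I)
    (hηpos : ∀ j, ∀ t ∈ I, 0 < η j t) {p : domain I m} {l : Filter (domain I m)}
    (ht : Tendsto (fun q : domain I m => q.1.1) l (𝓝 p.1.1))
    (hh : ∀ i, Tendsto (fun q : domain I m => hBlock a η q.1.1 q.1.2 i) l
      (𝓝 (hBlock a η p.1.1 p.1.2 i)))
    (hφ : ∀ i, Tendsto (fun q : domain I m => phiHatBlock D a η q.1.1 q.1.2 i) l
      (𝓝 (phiHatBlock D a η p.1.1 p.1.2 i))) : l ≤ 𝓝 p := by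
  have hp := p.2.1
  have hcomp : ∀ {f : ℝ → ℝ}, ContDiffOn ℝ ∞ f I →
      Tendsto (fun q : domain I m => f q.1.1) l (𝓝 (f p.1.1)) := fun hf =>
    (hf.continuousOn.continuousAt (hI.mem_nhds hp)).tendsto.comp ht
  refine tendsto_id'.1 (tendsto_subtype_rng.2 ((Prod.tendsto_iff _ _).2
    ⟨ht, tendsto_pi_nhds.2 fun k => ?_⟩))
  simp only [id]
  have hηk := hcomp (hη k)
  rcases lt_or_ge (k : ℕ) a with hk | hk
  · have h1 := (hh (⟨k, hk⟩, 1)).div hηk (hηpos k _ hp).ne'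
    have h2 := (Real.continuous_arsinh.tendsto _).comp h1
    have e : ∀ q : domain I m, Real.arsinh (hBlock a η q.1.1 q.1.2 (⟨k, hk⟩, 1) / η k q.1.1) =
        q.1.2 k := fun q => by
      change Real.arsinh (η k q.1.1 * Real.sinh (q.1.2 k) / η k q.1.1) = _
      rw [mul_div_cancel_left₀ _ (hηpos k _ q.2.1).ne', Real.arsinh_sinh]
    rw [e] at h2
    exact h2.congr e
  · obtain ⟨j, hj⟩ : ∃ j, psi D j p.1.1 ≠ 0 := by
      by_contra! hcon
      have := psi_sq_add_psi_sq D p.1.1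
      rw [hcon, hcon] at this
      norm_num at this
    have hχ0 : chi D j p.1.1 ≠ 0 := div_ne_zero hj (D.S_pos j _ hp).ne'
    have hχ := hcomp (contDiffOn_chi D hI j)
    have hψ := hcomp (contDiffOn_psi D hI j)
    have hR := hηk.mul hχ
    have hR0 : η k p.1.1 * chi D j p.1.1 ≠ 0 := mul_ne_zero (hηpos k _ hp).ne' hχ0
    have h1 : Tendsto (fun q : domain I m => D.S j q.1.1 * q.1.2 k) l
        (𝓝 (D.S j p.1.1 * p.1.2 k)) := by
      refine tendsto_of_tendsto_mul_g_T₁ hR0 (hR.eventually_ne hR0) fun i => ?_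
      have e : ∀ q : domain I m, phiHatBlock D a η q.1.1 q.1.2 (⟨k, hk⟩, (j, 0), i) =
          η k q.1.1 * chi D j q.1.1 * g (T₁ (D.S j q.1.1 * q.1.2 k)) i := fun q => by
        simp only [phiHatBlock, phiHat, Pi.smul_apply, smul_eq_mul, mul_assoc]
        rfl
      have h2 := hφ (⟨k, hk⟩, (j, 0), i)
      rw [e] at h2
      exact h2.congr e
    -- The step function is the quotient of `ψ_j` and `χ_j`, hence continuous where `ψ_j ≠ 0`.
    have hS : Tendsto (fun q : domain I m => D.S j q.1.1) l (𝓝 (D.S j p.1.1)) := by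
      have h3 := hψ.div hχ hχ0
      have e : ∀ q : domain I m, psi D j q.1.1 ≠ 0 →
          psi D j q.1.1 / chi D j q.1.1 = D.S j q.1.1 := fun q hq => by
        rw [chi, div_div_cancel₀ hq]
      rw [e p hj] at h3
      refine h3.congr' ?_
      filter_upwards [hψ.eventually_ne hj] with q hq
      exact e q hq
    have h4 := h1.div hS (D.S_pos j _ hp).ne'
    have e : ∀ q : domain I m, D.S j q.1.1 * q.1.2 k / D.S j q.1.1 = q.1.2 k := fun q =>
      mul_div_cancel_left₀ _ (D.S_pos j _ q.2.1).ne'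
    rw [e] at h4
    exact h4.congr e

end limits

/-! ### Radii and radicands of the six maps -/

/-- A warped product together with auxiliary choices for which `α` and `ε²` are small. -/
structure IsAdmissible {I : Set ℝ} {m : ℕ} (D : Choices I) (a : ℕ) (c : ℝ) (ρ : ℝ → ℝ)
    (η : Fin m → ℝ → ℝ) : Prop where
  isOpen : IsOpen I
  ordConnected : I.OrdConnected
  smooth_ρ : ContDiffOn ℝ ∞ ρ I
  ρ_pos : ∀ t ∈ I, 0 < ρ t
  smooth_η : ∀ j, ContDiffOn ℝ ∞ (η j) I
  η_pos : ∀ j, ∀ t ∈ I, 0 < η j t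
  c_pos : 0 < c
  alpha_le : ∀ t ∈ I, alpha D a η t ≤ 1 / (8 * c)
  epsSq_le : ∀ t ∈ I, 8 * epsSq D a η t ≤ ρ t ^ 2

namespace IsAdmissible

variable {I : Set ℝ} {m N : ℕ} {D : Choices I} {a : ℕ} {c : ℝ} {ρ : ℝ → ℝ} {η : Fin m → ℝ → ℝ}
  {t : ℝ}

lemma smooth_alpha (H : IsAdmissible D a c ρ η) :
    ContDiffOn ℝ ∞ (alpha D a η) I :=
  contDiffOn_alpha D a H.isOpen H.smooth_η

lemma smooth_epsSq (H : IsAdmissible D a c ρ η) :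
    ContDiffOn ℝ ∞ (epsSq D a η) I :=
  contDiffOn_epsSq D a H.isOpen H.smooth_η

lemma smooth_deriv (H : IsAdmissible D a c ρ η)
    {f : ℝ → ℝ} (hf : ContDiffOn ℝ ∞ f I) : ContDiffOn ℝ ∞ (deriv f) I :=
  ((contDiffOn_infty_iff_deriv_of_isOpen H.isOpen).1 hf).2

lemma smooth_beta (H : IsAdmissible D a c ρ η) : ContDiffOn ℝ ∞ (beta D a η) I :=
  H.smooth_alpha.sub (contDiffOn_loSq a H.smooth_η)

lemma smooth_radSq (H : IsAdmissible D a c ρ η) : ContDiffOn ℝ ∞ (radSq D a c η) I :=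
  (contDiffOn_const.add ((contDiffOn_loSq a H.smooth_η).div_const 2)).sub H.smooth_alpha

lemma one_div_sub_beta_pos (H : IsAdmissible D a c ρ η) (ht : t ∈ I) : 0 < 1 / c - beta D a η t :=
  (half_one_div_add_loSq_pos H.c_pos).trans_le (one_div_sub_beta_ge H.c_pos (H.alpha_le t ht))

lemma radSq_pos (H : IsAdmissible D a c ρ η) (ht : t ∈ I) : 0 < radSq D a c η t := by
  have := (half_one_div_add_loSq_pos H.c_pos).trans_le
    (two_mul_radSq_ge H.c_pos (H.alpha_le t ht))
  linarith

lemma one_div_add_alpha_pos (H : IsAdmissible D a c ρ η) (t : ℝ) : 0 < 1 / c + alpha D a η t :=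
  add_pos_of_pos_of_nonneg (one_div_pos.2 H.c_pos) (alpha_nonneg D a t)

lemma one_div_add_two_mul_alpha_pos (H : IsAdmissible D a c ρ η)
    (t : ℝ) : 0 < 1 / c + 2 * alpha D a η t :=
  add_pos_of_pos_of_nonneg (one_div_pos.2 H.c_pos)
    (mul_nonneg zero_le_two (alpha_nonneg D a t))

lemma two_mul_epsSq_lt (H : IsAdmissible D a c ρ η) (ht : t ∈ I) : 2 * epsSq D a η t < ρ t ^ 2 := by
  have := H.epsSq_le t ht
  have := pow_pos (H.ρ_pos t ht) 2
  linarith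

lemma epsSq_lt (H : IsAdmissible D a c ρ η) (ht : t ∈ I) : epsSq D a η t < ρ t ^ 2 := by
  have := H.two_mul_epsSq_lt ht
  have := epsSq_nonneg D a (η := η) t
  linarith

/-! ### Maps into semi-Euclidean space -/

lemma smooth_radicandR (H : IsAdmissible D a c ρ η) (k : ℝ) :
    ContDiffOn ℝ ∞ (fun τ => ρ τ ^ 2 + loDerivSq a η τ - k * epsSq D a η τ) I :=
  ((H.smooth_ρ.pow 2).add (contDiffOn_loDerivSq a H.isOpen H.smooth_η)).sub
    (contDiffOn_const.mul H.smooth_epsSq)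

lemma isometric_euclidean (H : IsAdmissible D a c ρ η)
    {β : Type} [Fintype β] {B : ℝ → (Fin m → ℝ) → β → ℝ} {κ ν : ℝ → ℝ}
    (hB : IsEuclideanBlock I a η B κ ν)
    (hκ : ContDiffOn ℝ ∞ (fun τ => ρ τ ^ 2 + loDerivSq a η τ - κ τ) I)
    (hpos : ∀ t ∈ I, 0 < ρ t ^ 2 + loDerivSq a η t - κ t)
    (e : Fin N ≃ Unit ⊕ (Lo m a × Fin 2) ⊕ β) (he : ∀ i, sgnRS Unit m a β (e i) = sgn a i) :
    IsIsometricImmersion I ρ η a univ (fun p i => sphericalMap a η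
      (fun t _ => ∫ τ in D.t₀..t, Real.sqrt (ρ τ ^ 2 + loDerivSq a η τ - κ τ)) B p (e i)) := by
  refine sphericalMap_isIsometricImmersion H.isOpen H.ρ_pos H.smooth_η H.η_pos hB (fun _ =>
    contDiffOn_integral_sqrt H.isOpen H.ordConnected D.t₀_mem hκ hpos) (fun t ht => ?_)
    (fun _ _ _ _ => mem_univ _) e he
  rw [Fintype.sum_unique, (hasDerivAt_integral_sqrt H.isOpen H.ordConnected D.t₀_mem
    hκ.continuousOn ht).deriv, Real.sq_sqrt (hpos t ht).le]

lemma immersionR (H : IsAdmissible D a c ρ η)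
    (e : Fin N ≃ Unit ⊕ (Lo m a × Fin 2) ⊕ (Hi m a × Fin 2 × Fin 2))
    (he : ∀ i, sgnRS Unit m a _ (e i) = sgn a i) :
    IsIsometricImmersion I ρ η a univ (fun p i => mapR D a ρ η p (e i)) := by
  have h1 := H.smooth_radicandR 1
  simp only [one_mul] at h1
  refine H.isometric_euclidean (isEuclideanBlock_phiBlock D H.isOpen H.smooth_η) h1
    (fun t ht => ?_) e he
  have := H.epsSq_lt ht
  have := loDerivSq_nonneg (a := a) (η := η) (t := t)
  linarith

lemma radicandHatR_pos (H : IsAdmissible D a c ρ η) (ht : t ∈ I) :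
    0 < ρ t ^ 2 + loDerivSq a η t - 2 * epsSq D a η t := by
  have := H.two_mul_epsSq_lt ht
  have := loDerivSq_nonneg (a := a) (η := η) (t := t)
  linarith

lemma embeddingR (H : IsAdmissible D a c ρ η)
    (e : Fin N ≃ Unit ⊕ (Lo m a × Fin 2) ⊕ (Hi m a × (Fin 2 × Fin 2) × Fin 2))
    (he : ∀ i, sgnRS Unit m a _ (e i) = sgn a i) :
    IsIsometricEmbedding I ρ η a univ (fun p i => mapHatR D a ρ η p (e i)) := by
  have himm : IsIsometricImmersion I ρ η a univ (fun p i => mapHatR D a ρ η p (e i)) :=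
    H.isometric_euclidean (isEuclideanBlock_phiHatBlock D H.isOpen H.smooth_η)
      (H.smooth_radicandR 2) (fun t ht => H.radicandHatR_pos ht) e he
  refine himm.isIsometricEmbedding e (fun _ _ => rfl) fun p l hl => ?_
  refine le_nhds_of_tendsto_blocks D H.isOpen H.smooth_η H.η_pos ?_
    (fun i => hl (Sum.inr (Sum.inl i))) (fun i => hl (Sum.inr (Sum.inr i)))
  exact tendsto_of_tendsto_strictMonoOn H.isOpen (strictMonoOn_integral_sqrt H.isOpen
    H.ordConnected D.t₀_mem (H.smooth_radicandR 2).continuousOn fun t ht => H.radicandHatR_pos ht)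
    (fun q => q.2.1) p.2.1 (hl (Sum.inl ()))

/-! ### Maps into the quadrics of positive curvature -/

lemma smooth_radicandS (H : IsAdmissible D a c ρ η) :
    ContDiffOn ℝ ∞ (fun τ => 1 / (1 / c - beta D a η τ) *
    (ρ τ ^ 2 + loDerivSq a η τ - epsSq D a η τ
      - deriv (beta D a η) τ ^ 2 / (4 * (1 / c - beta D a η τ)))) I := by
  have hw : ContDiffOn ℝ ∞ (fun τ => 1 / c - beta D a η τ) I := contDiffOn_const.sub H.smooth_beta
  have h1 := H.smooth_radicandR 1
  simp only [one_mul] at h1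
  exact (contDiffOn_const.div hw fun t ht => (H.one_div_sub_beta_pos ht).ne').mul
    (h1.sub (((H.smooth_deriv H.smooth_beta).pow 2).div (contDiffOn_const.mul hw)
      fun t ht => mul_ne_zero four_ne_zero (H.one_div_sub_beta_pos ht).ne'))

lemma immersionS (H : IsAdmissible D a c ρ η)
    (e : Fin (N + 1) ≃ Fin 2 ⊕ (Lo m a × Fin 2) ⊕ (Hi m a × Fin 2 × Fin 2))
    (he : ∀ i, sgnRS (Fin 2) m a _ (e i) = sgn a i) :
    IsIsometricImmersion I ρ η a (quadricS N a c) (fun p i => mapS D a c ρ η p (e i)) := by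
  have hpos := fun t (ht : t ∈ I) => radicandS_pos H.isOpen H.smooth_η H.c_pos ht (H.ρ_pos t ht)
    (H.alpha_le t ht) (H.epsSq_le t ht)
  have hw : ContDiffOn ℝ ∞ (fun τ => 1 / c - beta D a η τ) I := contDiffOn_const.sub H.smooth_beta
  have hθ : ContDiffOn ℝ ∞ (thetaS D a c ρ η) I :=
    contDiffOn_integral_sqrt H.isOpen H.ordConnected D.t₀_mem H.smooth_radicandS hpos
  refine sphericalMap_isIsometricImmersion
    (u := fun t i => Real.sqrt (1 / c - beta D a η t) * g (thetaS D a c ρ η t) i)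
    H.isOpen H.ρ_pos H.smooth_η H.η_pos (isEuclideanBlock_phiBlock D H.isOpen H.smooth_η)
    (fun i => (hw.sqrt fun t ht => (H.one_div_sub_beta_pos ht).ne').mul
      ((contDiff_g i).comp_contDiffOn hθ)) (fun t ht => ?_) (fun t ht y hy => ?_) e he
  · have hw0 := H.one_div_sub_beta_pos ht
    obtain ⟨R', hR, hR2⟩ := hasDerivAt_sqrt_sq
      ((hasDerivAt_of_contDiffOn H.isOpen H.smooth_beta ht).const_sub (1 / c)) hw0
    have hd : HasDerivAt (thetaS D a c ρ η) _ t := hasDerivAt_integral_sqrt H.isOpen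
      H.ordConnected D.t₀_mem H.smooth_radicandS.continuousOn ht
    rw [sum_sq_deriv_g hR hd, hR2, Real.sq_sqrt hw0.le, Real.sq_sqrt (hpos t ht).le, neg_sq,
      ← mul_assoc, mul_one_div_cancel hw0.ne']
    ring
  · change semiInner a y y = 1 / c
    rw [hy, sum_sq_g, Real.sq_sqrt (H.one_div_sub_beta_pos ht).le, beta]
    ring

lemma smooth_radicandHatS (H : IsAdmissible D a c ρ η) : ContDiffOn ℝ ∞ (fun τ =>
    (ρ τ ^ 2 + loDerivSq a η τ - 2 * epsSq D a η τ
      - 2 * (deriv (fun s => -alpha D a η s + loSq a η s / 2) τ ^ 2 / (4 * radSq D a c η τ)))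
      / radSq D a c η τ) I := by
  have h1 : ContDiffOn ℝ ∞ (fun s => -alpha D a η s + loSq a η s / 2) I :=
    H.smooth_alpha.neg.add ((contDiffOn_loSq a H.smooth_η).div_const 2)
  exact ((H.smooth_radicandR 2).sub (contDiffOn_const.mul (((H.smooth_deriv h1).pow 2).div
    (contDiffOn_const.mul H.smooth_radSq)
      fun t ht => mul_ne_zero four_ne_zero (H.radSq_pos ht).ne'))).div H.smooth_radSq
      fun t ht => (H.radSq_pos ht).ne'

lemma embeddingS (H : IsAdmissible D a c ρ η)
    (e : Fin (N + 1) ≃ (Fin 2 × Fin 2) ⊕ (Lo m a × Fin 2) ⊕ (Hi m a × (Fin 2 × Fin 2) × Fin 2))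
    (he : ∀ i, sgnRS (Fin 2 × Fin 2) m a _ (e i) = sgn a i) :
    IsIsometricEmbedding I ρ η a (quadricS N a c) (fun p i => mapHatS D a c ρ η p (e i)) := by
  have hpos := fun t (ht : t ∈ I) => radicandHatS_pos H.isOpen H.smooth_η H.c_pos ht
    (H.ρ_pos t ht) (H.alpha_le t ht) (H.epsSq_le t ht)
  have hθ : ContDiffOn ℝ ∞ (thetaHatS D a c ρ η) I :=
    contDiffOn_integral_sqrt H.isOpen H.ordConnected D.t₀_mem H.smooth_radicandHatS hpos
  have himm : IsIsometricImmersion I ρ η a (quadricS N a c)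
      (fun p i => mapHatS D a c ρ η p (e i)) := by
    refine sphericalMap_isIsometricImmersion (A := Fin 2 × Fin 2)
      (u := fun t q => Real.sqrt (radSq D a c η t) * g (T q.1 (thetaHatS D a c ρ η t)) q.2)
      H.isOpen H.ρ_pos H.smooth_η H.η_pos (isEuclideanBlock_phiHatBlock D H.isOpen H.smooth_η)
      (fun q => (H.smooth_radSq.sqrt fun t ht => (H.radSq_pos ht).ne').mul
        ((contDiff_g_T q.1 q.2).comp_contDiffOn hθ)) (fun t ht => ?_) (fun t ht y hy => ?_) e he
    · have hw0 := H.radSq_pos ht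
      obtain ⟨R', hR, hR2⟩ := hasDerivAt_sqrt_sq
        (hasDerivAt_of_contDiffOn H.isOpen H.smooth_radSq ht) hw0
      have hd : HasDerivAt (thetaHatS D a c ρ η) _ t := hasDerivAt_integral_sqrt H.isOpen
        H.ordConnected D.t₀_mem H.smooth_radicandHatS.continuousOn ht
      have hrad : deriv (fun s => -alpha D a η s + loSq a η s / 2) t =
          deriv (radSq D a c η) t := by
        rw [← deriv_const_add (1 / (2 * c))]
        congr 1
        funext s
        rw [radSq]
        ring
      rw [sum_sq_deriv_g_T hR hd, hR2, Real.sq_sqrt hw0.le, Real.sq_sqrt (hpos t ht).le,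
        mul_div_cancel₀ _ hw0.ne', hrad]
      ring
    · change semiInner a y y = 1 / c
      rw [hy, sum_sq_g_T, Real.sq_sqrt (H.radSq_pos ht).le, radSq]
      have := H.c_pos.ne'
      field_simp
      ring
  refine himm.isIsometricEmbedding e (fun _ _ => rfl) fun p l hl => ?_
  refine le_nhds_of_tendsto_blocks D H.isOpen H.smooth_η H.η_pos ?_
    (fun i => hl (Sum.inr (Sum.inl i))) (fun i => hl (Sum.inr (Sum.inr i)))
  have hmono : StrictMonoOn (thetaHatS D a c ρ η) I := strictMonoOn_integral_sqrt H.isOpen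
    H.ordConnected D.t₀_mem H.smooth_radicandHatS.continuousOn hpos
  refine tendsto_of_tendsto_strictMonoOn H.isOpen hmono (fun q => q.2.1) p.2.1 ?_
  exact tendsto_of_tendsto_mul_g_T₁ (Real.sqrt_pos.2 (H.radSq_pos p.2.1)).ne'
    (Eventually.of_forall fun q => (Real.sqrt_pos.2 (H.radSq_pos q.2.1)).ne')
    fun i => hl (Sum.inl (0, i))

/-! ### Maps into the quadrics of negative curvature -/

lemma smooth_radicandH (H : IsAdmissible D a c ρ η) :
    ContDiffOn ℝ ∞ (fun τ => 1 / (1 / c + alpha D a η τ) *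
    (ρ τ ^ 2 - epsSq D a η τ + deriv (alpha D a η) τ ^ 2 / (4 * (1 / c + alpha D a η τ)))) I := by
  have hw : ContDiffOn ℝ ∞ (fun τ => 1 / c + alpha D a η τ) I := contDiffOn_const.add H.smooth_alpha
  exact (contDiffOn_const.div hw fun t _ => (H.one_div_add_alpha_pos t).ne').mul
    (((H.smooth_ρ.pow 2).sub H.smooth_epsSq).add (((H.smooth_deriv H.smooth_alpha).pow 2).div
      (contDiffOn_const.mul hw)
      fun t _ => mul_ne_zero four_ne_zero (H.one_div_add_alpha_pos t).ne'))

lemma radicandH_pos (H : IsAdmissible D a c ρ η) (ht : t ∈ I) : 0 < 1 / (1 / c + alpha D a η t) *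
    (ρ t ^ 2 - epsSq D a η t + deriv (alpha D a η) t ^ 2 / (4 * (1 / c + alpha D a η t))) := by
  have h1 := H.one_div_add_alpha_pos t
  have h2 : 0 < ρ t ^ 2 - epsSq D a η t := sub_pos.2 (H.epsSq_lt ht)
  positivity

lemma immersionH (H : IsAdmissible D a c ρ η)
    (e : Fin (N + 1) ≃ Fin 2 ⊕ Lo m a ⊕ (Lo m a × Fin 2) ⊕ (Hi m a × Fin 2 × Fin 2))
    (he : ∀ i, sgnH m a _ (e i) = sgn (a + 1) i) :
    IsIsometricImmersion I ρ η (a + 1) (quadricH N a c) (fun p i => mapH D a c ρ η p (e i)) := by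
  have hw : ContDiffOn ℝ ∞ (fun τ => 1 / c + alpha D a η τ) I := contDiffOn_const.add H.smooth_alpha
  have hθ : ContDiffOn ℝ ∞ (thetaH D a c ρ η) I := contDiffOn_integral_sqrt H.isOpen
    H.ordConnected D.t₀_mem H.smooth_radicandH fun t ht => H.radicandH_pos ht
  refine hyperbolicMap_isIsometricImmersion
    (u := fun t i => Real.sqrt (1 / c + alpha D a η t) * h (thetaH D a c ρ η t) i)
    H.isOpen H.ρ_pos H.smooth_η H.η_pos (isEuclideanBlock_phiBlock D H.isOpen H.smooth_η)
    (fun i => (hw.sqrt fun t _ => (H.one_div_add_alpha_pos t).ne').mul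
      ((contDiff_h i).comp_contDiffOn hθ)) (fun t ht => ?_) (fun t ht y hy => ?_) e he
  · have hw0 := H.one_div_add_alpha_pos t
    obtain ⟨R', hR, hR2⟩ := hasDerivAt_sqrt_sq
      ((hasDerivAt_of_contDiffOn H.isOpen H.smooth_alpha ht).const_add (1 / c)) hw0
    have hd : HasDerivAt (thetaH D a c ρ η) _ t := hasDerivAt_integral_sqrt H.isOpen
      H.ordConnected D.t₀_mem H.smooth_radicandH.continuousOn ht
    rw [sum_sgn_sq_deriv_h hR hd, hR2, Real.sq_sqrt hw0.le, Real.sq_sqrt (H.radicandH_pos ht).le,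
      ← mul_assoc, mul_one_div_cancel hw0.ne']
    ring
  · change semiInner (a + 1) y y = -1 / c
    rw [hy, sum_sgn_sq_h, Real.sq_sqrt (H.one_div_add_alpha_pos t).le]
    ring

lemma smooth_radicandHatH (H : IsAdmissible D a c ρ η) :
    ContDiffOn ℝ ∞ (fun τ => 1 / (1 / c + 2 * alpha D a η τ) *
    (ρ τ ^ 2 - 2 * epsSq D a η τ +
      deriv (alpha D a η) τ ^ 2 / (1 / c + 2 * alpha D a η τ))) I := by
  have hw : ContDiffOn ℝ ∞ (fun τ => 1 / c + 2 * alpha D a η τ) I :=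
    contDiffOn_const.add (contDiffOn_const.mul H.smooth_alpha)
  exact (contDiffOn_const.div hw fun t _ => (H.one_div_add_two_mul_alpha_pos t).ne').mul
    (((H.smooth_ρ.pow 2).sub (contDiffOn_const.mul H.smooth_epsSq)).add
      (((H.smooth_deriv H.smooth_alpha).pow 2).div hw
      fun t _ => (H.one_div_add_two_mul_alpha_pos t).ne'))

lemma radicandHatH_pos (H : IsAdmissible D a c ρ η)
    (ht : t ∈ I) : 0 < 1 / (1 / c + 2 * alpha D a η t) *
    (ρ t ^ 2 - 2 * epsSq D a η t +
      deriv (alpha D a η) t ^ 2 / (1 / c + 2 * alpha D a η t)) := by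
  have h1 := H.one_div_add_two_mul_alpha_pos t
  have h2 : 0 < ρ t ^ 2 - 2 * epsSq D a η t := sub_pos.2 (H.two_mul_epsSq_lt ht)
  positivity

lemma embeddingH (H : IsAdmissible D a c ρ η)
    (e : Fin (N + 1) ≃ Fin 2 ⊕ Lo m a ⊕ (Lo m a × Fin 2) ⊕ (Hi m a × (Fin 2 × Fin 2) × Fin 2))
    (he : ∀ i, sgnH m a _ (e i) = sgn (a + 1) i) :
    IsIsometricEmbedding I ρ η (a + 1) (quadricH N a c)
      (fun p i => mapHatH D a c ρ η p (e i)) := by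
  have hw : ContDiffOn ℝ ∞ (fun τ => 1 / c + 2 * alpha D a η τ) I :=
    contDiffOn_const.add (contDiffOn_const.mul H.smooth_alpha)
  have hθ : ContDiffOn ℝ ∞ (thetaHatH D a c ρ η) I := contDiffOn_integral_sqrt H.isOpen
    H.ordConnected D.t₀_mem H.smooth_radicandHatH fun t ht => H.radicandHatH_pos ht
  have himm : IsIsometricImmersion I ρ η (a + 1) (quadricH N a c)
      (fun p i => mapHatH D a c ρ η p (e i)) := by
    refine hyperbolicMap_isIsometricImmersion
      (u := fun t i => Real.sqrt (1 / c + 2 * alpha D a η t) * h (thetaHatH D a c ρ η t) i)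
      H.isOpen H.ρ_pos H.smooth_η H.η_pos (isEuclideanBlock_phiHatBlock D H.isOpen H.smooth_η)
      (fun i => (hw.sqrt fun t _ => (H.one_div_add_two_mul_alpha_pos t).ne').mul
        ((contDiff_h i).comp_contDiffOn hθ)) (fun t ht => ?_) (fun t ht y hy => ?_) e he
    · have hw0 := H.one_div_add_two_mul_alpha_pos t
      obtain ⟨R', hR, hR2⟩ := hasDerivAt_sqrt_sq
        (((hasDerivAt_of_contDiffOn H.isOpen H.smooth_alpha ht).const_mul 2).const_add (1 / c)) hw0
      have hd : HasDerivAt (thetaHatH D a c ρ η) _ t := hasDerivAt_integral_sqrt H.isOpen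
        H.ordConnected D.t₀_mem H.smooth_radicandHatH.continuousOn ht
      rw [sum_sgn_sq_deriv_h hR hd, hR2, Real.sq_sqrt hw0.le,
        Real.sq_sqrt (H.radicandHatH_pos ht).le, ← mul_assoc, mul_one_div_cancel hw0.ne', mul_pow,
        show (2 : ℝ) ^ 2 = 4 by norm_num, mul_div_mul_left _ _ four_ne_zero]
      ring
    · change semiInner (a + 1) y y = -1 / c
      rw [hy, sum_sgn_sq_h, Real.sq_sqrt (H.one_div_add_two_mul_alpha_pos t).le]
      ring
  refine himm.isIsometricEmbedding e (fun _ _ => rfl) fun p l hl => ?_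
  refine le_nhds_of_tendsto_blocks D H.isOpen H.smooth_η H.η_pos ?_
    (fun i => hl (Sum.inr (Sum.inr (Sum.inl i)))) (fun i => hl (Sum.inr (Sum.inr (Sum.inr i))))
  have hmono : StrictMonoOn (thetaHatH D a c ρ η) I := strictMonoOn_integral_sqrt H.isOpen
    H.ordConnected D.t₀_mem H.smooth_radicandHatH.continuousOn fun t ht => H.radicandHatH_pos ht
  refine tendsto_of_tendsto_strictMonoOn H.isOpen hmono (fun q => q.2.1) p.2.1 ?_
  exact tendsto_of_tendsto_mul_h
    (Real.sqrt_pos.2 (H.one_div_add_two_mul_alpha_pos p.1.1)).ne'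
    (fun q => (Real.sqrt_pos.2 (H.one_div_add_two_mul_alpha_pos q.1.1)).ne')
    fun i => hl (Sum.inl i)

end IsAdmissible

end WarpedQuadric

end

/-! ### Existence of the six maps -/

theorem theorem1 (n : ℕ) (hn : 1 ≤ n) (I : Set ℝ) (hI : IsOpen I) (hIconn : I.OrdConnected)
    (hIne : I.Nonempty) (ρ : ℝ → ℝ) (η : Fin (n - 1) → ℝ → ℝ)
    (hρ : ContDiffOn ℝ ∞ ρ I) (hρpos : ∀ t ∈ I, 0 < ρ t)
    (hη : ∀ j, ContDiffOn ℝ ∞ (η j) I) (hηpos : ∀ j, ∀ t ∈ I, 0 < η j t)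
    (c : ℝ) (hc : 0 < c) (a : ℕ) (ha : a ≤ n - 1) :
    -- isometric immersions
    (∃ f : ℝ × (Fin (n - 1) → ℝ) → Fin (4 * n - 3 - 2 * a) → ℝ,
      WarpedQuadric.IsIsometricImmersion I ρ η a Set.univ f ∧
      ∃ D : WarpedQuadric.Choices I, WarpedQuadric.IsGivenBy I a
        (WarpedQuadric.sgnRS _ (n - 1) a _) (WarpedQuadric.mapR D a ρ η) f) ∧
    (∃ f : ℝ × (Fin (n - 1) → ℝ) → Fin (4 * n - 3 - 2 * a + 1) → ℝ,
      WarpedQuadric.IsIsometricImmersion I ρ η a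
        (WarpedQuadric.quadricS (4 * n - 3 - 2 * a) a c) f ∧
      ∃ D : WarpedQuadric.Choices I, WarpedQuadric.IsGivenBy I a
        (WarpedQuadric.sgnRS _ (n - 1) a _) (WarpedQuadric.mapS D a c ρ η) f) ∧
    (∃ f : ℝ × (Fin (n - 1) → ℝ) → Fin (4 * n - 3 - a + 1) → ℝ,
      WarpedQuadric.IsIsometricImmersion I ρ η (a + 1)
        (WarpedQuadric.quadricH (4 * n - 3 - a) a c) f ∧
      ∃ D : WarpedQuadric.Choices I, WarpedQuadric.IsGivenBy I (a + 1)
        (WarpedQuadric.sgnH (n - 1) a _) (WarpedQuadric.mapH D a c ρ η) f) ∧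
    -- isometric embeddings
    (∃ f : ℝ × (Fin (n - 1) → ℝ) → Fin (8 * n - 7 - 6 * a) → ℝ,
      WarpedQuadric.IsIsometricEmbedding I ρ η a Set.univ f ∧
      ∃ D : WarpedQuadric.Choices I, WarpedQuadric.IsGivenBy I a
        (WarpedQuadric.sgnRS _ (n - 1) a _) (WarpedQuadric.mapHatR D a ρ η) f) ∧
    (∃ f : ℝ × (Fin (n - 1) → ℝ) → Fin (8 * n - 5 - 6 * a + 1) → ℝ,
      WarpedQuadric.IsIsometricEmbedding I ρ η a
        (WarpedQuadric.quadricS (8 * n - 5 - 6 * a) a c) f ∧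
      ∃ D : WarpedQuadric.Choices I, WarpedQuadric.IsGivenBy I a
        (WarpedQuadric.sgnRS _ (n - 1) a _) (WarpedQuadric.mapHatS D a c ρ η) f) ∧
    (∃ f : ℝ × (Fin (n - 1) → ℝ) → Fin (8 * n - 7 - 5 * a + 1) → ℝ,
      WarpedQuadric.IsIsometricEmbedding I ρ η (a + 1)
        (WarpedQuadric.quadricH (8 * n - 7 - 5 * a) a c) f ∧
      ∃ D : WarpedQuadric.Choices I, WarpedQuadric.IsGivenBy I (a + 1)
        (WarpedQuadric.sgnH (n - 1) a _) (WarpedQuadric.mapHatH D a c ρ η) f) := by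
  obtain ⟨D, hα, hε⟩ :=
    WarpedQuadric.exists_choices hI hIconn hIne hρ hρpos hη hc a
  have H : WarpedQuadric.IsAdmissible D a c ρ η :=
    ⟨hI, hIconn, hρ, hρpos, hη, hηpos, hc, hα, hε⟩
  have hφ : Fintype.card (WarpedQuadric.Hi (n - 1) a × Fin 2 × Fin 2) = (n - 1 - a) * 4 := by
    rw [Fintype.card_prod, WarpedQuadric.card_hi ha]
    rfl
  have hφ' : Fintype.card (WarpedQuadric.Hi (n - 1) a × (Fin 2 × Fin 2) × Fin 2) =
      (n - 1 - a) * 8 := by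
    rw [Fintype.card_prod, WarpedQuadric.card_hi ha]
    rfl
  have h1 : Fintype.card Unit = 1 := rfl
  have h2 : Fintype.card (Fin 2) = 2 := rfl
  have h4 : Fintype.card (Fin 2 × Fin 2) = 4 := rfl
  refine ⟨?_, ?_, ?_, ?_, ?_, ?_⟩
  · obtain ⟨e, he⟩ := WarpedQuadric.exists_reordering_sgnRS (A := Unit)
      (β := WarpedQuadric.Hi (n - 1) a × Fin 2 × Fin 2) ha
      (N := 4 * n - 3 - 2 * a) (by rw [hφ, h1]; omega)
    exact ⟨_, H.immersionR e he, D, e, he, fun _ _ _ => rfl⟩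
  · obtain ⟨e, he⟩ := WarpedQuadric.exists_reordering_sgnRS (A := Fin 2)
      (β := WarpedQuadric.Hi (n - 1) a × Fin 2 × Fin 2) ha
      (N := 4 * n - 3 - 2 * a + 1) (by rw [hφ, h2]; omega)
    exact ⟨_, H.immersionS e he, D, e, he, fun _ _ _ => rfl⟩
  · obtain ⟨e, he⟩ := WarpedQuadric.exists_reordering_sgnH
      (β := WarpedQuadric.Hi (n - 1) a × Fin 2 × Fin 2) ha
      (N := 4 * n - 3 - a + 1) (by rw [hφ]; omega)
    exact ⟨_, H.immersionH e he, D, e, he, fun _ _ _ => rfl⟩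
  · obtain ⟨e, he⟩ := WarpedQuadric.exists_reordering_sgnRS (A := Unit)
      (β := WarpedQuadric.Hi (n - 1) a × (Fin 2 × Fin 2) × Fin 2) ha
      (N := 8 * n - 7 - 6 * a) (by rw [hφ', h1]; omega)
    exact ⟨_, H.embeddingR e he, D, e, he, fun _ _ _ => rfl⟩
  · obtain ⟨e, he⟩ := WarpedQuadric.exists_reordering_sgnRS (A := Fin 2 × Fin 2)
      (β := WarpedQuadric.Hi (n - 1) a × (Fin 2 × Fin 2) × Fin 2) ha
      (N := 8 * n - 5 - 6 * a + 1) (by rw [hφ', h4]; omega)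
    exact ⟨_, H.embeddingS e he, D, e, he, fun _ _ _ => rfl⟩
  · obtain ⟨e, he⟩ := WarpedQuadric.exists_reordering_sgnH
      (β := WarpedQuadric.Hi (n - 1) a × (Fin 2 × Fin 2) × Fin 2) ha
      (N := 8 * n - 7 - 5 * a + 1) (by rw [hφ']; omega)
    exact ⟨_, H.embeddingH e he, D, e, he, fun _ _ _ => rfl⟩
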